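/- Let $n\ge 0$ and let $G$ be a simple graph on the vertex set $[n]=\{1,\dots,n\}$. Let $\mathrm{Shi}(G)$ (resp. $\mathrm{Ish}(G)$) be the arrangement in $\mathbb{R}^n$ consisting of the hyperplanes $x_i-x_j=0$ for all $1\le i<j\le n$ together with the hyperplanes $x_i-x_j=1$ (resp. $x_1-x_j=i$) for all edges $ij$ of $G$ with $i<j$. The regions of an arrangement $\mathcal A$ are the connected components of the complement of the union of its hyperplanes. A hyperplane of $\mathcal A$ is a wall of a region $R$ if it is the affine span of a face of the closure $\bar R$; a wall is a ceiling of $R$ if it does not contain the origin and $R$ and the origin lie in the same half-space of it. The number of degrees of freedom of $R$ is the dimension of its recession cone $\{v\in\mathbb{R}^n : v+R\subseteq R\}$. For a partition $\pi$ of $[n]$, a pair $i<j$ is an arc of $\pi$ if $i$ and $j$ lie in the same block and no $\ell$ with $i<\ell<j$ lies in that block. If the arcs are $a_1b_1,\dots,a_mb_m$ with $a_1<\dots<a_m$, then $\pi$ is written $(\mathbf a,\mathbf b)$ (endpoint notation), and $m=n-k$ when $\pi$ has $k$ blocks. The ceiling partition of a region $R$ of $\mathrm{Shi}(G)$ (resp.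 $\mathrm{Ish}(G)$) is the partition of $[n]$ whose arcs are exactly the pairs $i<j$ such that $x_i-x_j=1$ (resp. $x_1-x_j=i$) is a ceiling of $R$. Theorem. Let $\mathcal A$ be $\mathrm{Shi}(G)$ or $\mathrm{Ish}(G)$. Then $\mathcal A$ has finitely many regions, and every region of $\mathcal A$ has a unique ceiling partition. Let $(\mathbf a,\mathbf b)$ be a partition of $[n]$ with $k$ blocks. There is a region of $\mathcal A$ with ceiling partition $(\mathbf a,\mathbf b)$ if and only if every arc $a_ib_i$ is an edge of $G$. In that case: (1) the number of regions of $\mathcal A$ with ceiling partition $(\mathbf a,\mathbf b)$ is $$\frac{n!}{(n-k+1)!};$$ (2) for every integer $d$ with $1\le d\le k$, the number of regions of $\mathcal A$ with ceiling partition $(\mathbf a,\mathbf b)$ and $d$ degrees of freedom is $$N(n,k,d)=\frac{d\,(n-d-1)!\,(k-1)!}{(n-k-1)!\,(k-d)!}\quad\text{if } k<n,$$ while for $k=n$ it is $N(n,n,d)=n!$ if $d=n$ and $N(n,n,d)=0$ if $d<n$. Consequently, for integers $c\ge 0$ and $1\le d\le n-c$, the number of regions of $\mathcal A$ with $c$ ceilings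 and $d$ degrees of freedom is $\sum_\pi N(n,n-c,d)$, the sum being over all partitions $\pi$ of $[n]$ with $n-c$ blocks all of whose arcs are edges of $G$. In particular, for all nonnegative integers $c$ and $d$, the arrangements $\mathrm{Shi}(G)$ and $\mathrm{Ish}(G)$ have equally many regions with $c$ ceilings and $d$ degrees of freedom. -/

import Mathlib

open scoped Nat

namespace ShiIsh

/-! ### Set partitions -/

/-- A partition of the ground set `{1, …, n}`, which is modelled by `Fin n`
(the element `i : Fin n` stands for the number `i + 1`). -/
abbrev SetPartition (n : ℕ) : Type := Finpartition (Finset.univ : Finset (Fin n))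

/-- `i j` is an arc of the partition `P`: the elements `i < j` lie in a common block, and no element
strictly between them lies in that block. -/
def IsArc {n : ℕ} (P : SetPartition n) (i j : Fin n) : Prop :=
  i < j ∧ ∃ B ∈ P.parts, i ∈ B ∧ j ∈ B ∧ ∀ l : Fin n, i < l → l < j → l ∉ B

/-- `P` is a `G`-partition: every arc of `P` is an edge of `G`. -/
def IsGPartition {n : ℕ} (G : SimpleGraph (Fin n)) (P : SetPartition n) : Prop :=
  ∀ i j : Fin n, IsArc P i j → G.Adj i j

/-! ### The deleted Shi and Ish arrangements -/

/-- The Coxeter arrangement `x_i - x_j = 0`, `i < j`. -/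
def cox (n : ℕ) : Set (Set (Fin n → ℝ)) :=
  {H | ∃ i j : Fin n, i < j ∧ H = {x | x i - x j = 0}}

/-- The two families of arrangements. -/
inductive Kind : Type
  | shi : Kind
  | ish : Kind

/-- The hyperplane attached to the pair `i j`: in the Shi case it is `x_i - x_j = 1`, in the
Ish case it is `x_1 - x_j = i`. (The first coordinate is the one with index `0 : Fin n`, and
the number that `i : Fin n` stands for is `i + 1`.) -/
def edgeHyperplane {n : ℕ} (t : Kind) (i j : Fin n) : Set (Fin n → ℝ) :=
  match t with
  | Kind.shi => {x | x i - x j = 1}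
  | Kind.ish => {x | x ⟨0, j.pos⟩ - x j = ((i : ℕ) : ℝ) + 1}

/-- The deleted arrangement `Shi(G)` or `Ish(G)`: the Coxeter arrangement together with the
hyperplanes attached to the edges `i j`, `i < j`, of `G`. -/
def arrangement {n : ℕ} (t : Kind) (G : SimpleGraph (Fin n)) : Set (Set (Fin n → ℝ)) :=
  cox n ∪ {H | ∃ i j : Fin n, i < j ∧ G.Adj i j ∧ H = edgeHyperplane t i j}

/-! ### Regions, walls, ceilings, degrees of freedom -/

/-- The regions of an arrangement: the connected components of the complement of its union. -/
def regions {n : ℕ} (A : Set (Set (Fin n → ℝ))) : Set (Set (Fin n → ℝ)) :=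
  {R | ∃ x ∈ (⋃₀ A)ᶜ, R = connectedComponentIn (⋃₀ A)ᶜ x}

/-- The (closed) faces of a region `R`: the nonempty intersections of the closure of `R` with
intersections of hyperplanes of the arrangement. -/
def IsFace {n : ℕ} (A : Set (Set (Fin n → ℝ))) (R F : Set (Fin n → ℝ)) : Prop :=
  F.Nonempty ∧ ∃ S ⊆ A, F = closure R ∩ ⋂₀ S

/-- `H` is a wall of `R`: a hyperplane of the arrangement which is the affine span of a face of `R`
(this face has codimension one, since `H` has). -/
def IsWall {n : ℕ} (A : Set (Set (Fin n → ℝ))) (R H : Set (Fin n → ℝ)) : Prop :=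
  H ∈ A ∧ ∃ F, IsFace A R F ∧ (affineSpan ℝ F : Set (Fin n → ℝ)) = H

/-- `H` is a ceiling of `R`: a wall that does not contain the origin, with `R` and the origin in
the same half-space of `H` (two points lie in the same open half-space of `H` exactly when
the segment between them misses `H`). -/
def IsCeiling {n : ℕ} (A : Set (Set (Fin n → ℝ))) (R H : Set (Fin n → ℝ)) : Prop :=
  IsWall A R H ∧ (0 : Fin n → ℝ) ∉ H ∧ ∀ x ∈ R, Disjoint (segment ℝ 0 x) H

/-- The number of ceilings of `R`. -/
noncomputable def numCeilings {n : ℕ} (A : Set (Set (Fin n → ℝ))) (R : Set (Fin n → ℝ)) : ℕ :=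
  {H | IsCeiling A R H}.ncard

/-- The recession cone `{v | v + R ⊆ R}`. -/
def recessionCone {n : ℕ} (R : Set (Fin n → ℝ)) : Set (Fin n → ℝ) :=
  {v | ∀ x ∈ R, v + x ∈ R}

/-- The number of degrees of freedom of `R`: the dimension of its recession cone, which is the
dimension of the linear span since the cone contains the origin. -/
noncomputable def degreesOfFreedom {n : ℕ} (R : Set (Fin n → ℝ)) : ℕ :=
  Module.finrank ℝ (Submodule.span ℝ (recessionCone R))

/-! ### Ceiling partitions -/

/-- `P` is the ceiling partition of the region `R` of `Shi(G)` or `Ish(G)`: the arcs of `P` are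
exactly the pairs `i < j` whose hyperplane (`x_i - x_j = 1` for Shi, `x_1 - x_j = i` for Ish)
is a ceiling of `R`. -/
def IsCeilingPartition {n : ℕ} (t : Kind) (G : SimpleGraph (Fin n)) (R : Set (Fin n → ℝ))
    (P : SetPartition n) : Prop :=
  ∀ i j : Fin n, IsArc P i j ↔ i < j ∧ IsCeiling (arrangement t G) R (edgeHyperplane t i j)

/-- The number `d (n-d-1)! (k-1)! / ((n-k-1)! (k-d)!)`, used for `1 ≤ d ≤ k ≤ n`. For `k = n`, where
the factorials of `-1` have to be interpreted, it is `n!` if `d = n` and `0` if `d < n`. -/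
def ceilingDofCount (n k d : ℕ) : ℚ :=
  if k = n then (if d = n then (n ! : ℚ) else 0)
  else (d * (n - d - 1)! * (k - 1)! : ℚ) / ((n - k - 1)! * (k - d)! : ℚ)

end ShiIsh

namespace ShiIsh

/-! ### Arcs of set partitions -/

section Arcs

variable {n : ℕ} {P Q : SetPartition n} {i j k : Fin n}

/-! Let `σ` record the decreasing order of the coordinates on a region. In that chamber only pairs
`i j` with `src t i` before `j` matter, and `x (src t i) - x j < lev t i` implies the inequality of
`i' j'` whenever `key t σ i ≤ key t σ i'` and `σ j' ≤ σ j`. The satisfied inequalities thus form a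
lower set, and their maximal pairs are the ceilings. An antichain for a product of two linear orders
repeats neither a left nor a right end, so the maximal pairs are the arcs of a set partition.
Conversely, every lower set is realised by a point (`cell_nonempty`), and deleting one maximal pair
shows that its hyperplane is a ceiling (`isCeiling_regionOf_iff`). Regions therefore correspond to a
permutation `σ` and a compatible `G`-partition `P` (`exists_eq_regionOf`, `perm_eq_of_regionOf_eq`).

The recession cone spans the vectors that are constant from `src t a` to `b` for each arc `a b`, so
its dimension is the number of uncovered positions (`degreesOfFreedom_regionOf`).

It remains to count the compatible `σ` for a fixed `P`. Fill the positions from the left. The next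
element is either an unused start, chosen freely, or the single right end whose turn it is, which
exists exactly when some arc is open. Let `r` elements be pending and let `u` starts and `c` right
ends be unused. A start `x` raises `r` by its chain length `μ x`, a right end lowers `r` and `c` by
one, and the sum of the `μ x` over unused starts is `c - r`. The solutions of the recursion are
affine in `r`, so only this sum matters: the count sees neither the shape of the blocks nor the
difference between Shi and Ish. The next position is covered exactly when `r > 0`, which refines the
count by degrees of freedom. The empty prefix has `r = 0`, `u = k`, `c = n - k`. -/

theorem isArc_iff :
    IsArc P i j ↔ i < j ∧ P.part i = P.part j ∧ ∀ l, i < l → l < j → P.part l ≠ P.part i := by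
  refine and_congr_right fun _ => ⟨?_, ?_⟩
  · rintro ⟨B, hB, hi, hj, h⟩
    have ei := P.part_eq_of_mem hB hi
    refine ⟨ei.trans (P.part_eq_of_mem hB hj).symm, fun l h1 h2 h3 => h l h1 h2 ?_⟩
    rw [← ei, ← h3]
    exact P.mem_part (Finset.mem_univ _)
  · rintro ⟨h1, h2⟩
    refine ⟨P.part i, P.part_mem.2 (Finset.mem_univ _), P.mem_part (Finset.mem_univ _), ?_, ?_⟩
    · rw [h1]; exact P.mem_part (Finset.mem_univ _)
    · intro l hl hl' hm
      exact h2 l hl hl'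
        ((P.mem_part_iff_part_eq_part (Finset.mem_univ _) (Finset.mem_univ _)).1 hm)

theorem IsArc.lt (h : IsArc P i j) : i < j := h.1

theorem IsArc.part_eq (h : IsArc P i j) : P.part i = P.part j := (isArc_iff.1 h).2.1

theorem IsArc.right_unique (h : IsArc P i j) (h' : IsArc P i k) : j = k := by
  rw [isArc_iff] at h h'
  grind

theorem IsArc.left_unique (h : IsArc P i k) (h' : IsArc P j k) : i = j := by
  rw [isArc_iff] at h h'
  grind

theorem exists_isArc_left (hij : i < j) (h : P.part i = P.part j) : ∃ c, IsArc P c j ∧ i ≤ c := by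
  classical
  obtain ⟨c, hc, hmax⟩ := (Finset.univ.filter fun c => c < j ∧ P.part c = P.part j).exists_max_image
    id ⟨i, by simp [hij, h]⟩
  simp only [Finset.mem_filter, Finset.mem_univ, true_and, id] at hc hmax
  refine ⟨c, isArc_iff.2 ⟨hc.1, hc.2, fun l h1 h2 h3 => ?_⟩, hmax i ⟨hij, h⟩⟩
  exact absurd (hmax l ⟨h2, h3.trans hc.2⟩) (not_le.2 h1)

/-- Two elements of a block are joined by a chain of consecutive arcs; descend from the larger one.
-/
theorem part_eq_of_isArc_imp (h : ∀ i j, IsArc P i j → IsArc Q i j) :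
    ∀ i j : Fin n, i < j → P.part i = P.part j → Q.part i = Q.part j := by
  intro i j
  induction j using WellFoundedLT.induction with
  | ind j ih =>
    intro hij he
    obtain ⟨c, hc, hic⟩ := exists_isArc_left hij he
    have h1 := (h _ _ hc).part_eq
    rcases hic.eq_or_lt with rfl | hlt
    · exact h1
    · exact (ih c hc.lt hlt (he.trans hc.part_eq.symm)).trans h1

/-- A set partition is determined by its arcs. -/
theorem setPartition_ext (h : ∀ i j, IsArc P i j ↔ IsArc Q i j) : P = Q := by
  have key : ∀ i j : Fin n, P.part i = P.part j ↔ Q.part i = Q.part j := by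
    intro i j
    rcases lt_trichotomy i j with hij | rfl | hij
    · exact ⟨part_eq_of_isArc_imp (fun i j => (h i j).1) i j hij,
        part_eq_of_isArc_imp (fun i j => (h i j).2) i j hij⟩
    · simp
    · rw [eq_comm, eq_comm (a := Q.part i)]
      exact ⟨part_eq_of_isArc_imp (fun i j => (h i j).1) j i hij,
        part_eq_of_isArc_imp (fun i j => (h i j).2) j i hij⟩
  have hp : ∀ i, P.part i = Q.part i := by
    intro i
    ext j
    rw [P.mem_part_iff_part_eq_part (Finset.mem_univ _) (Finset.mem_univ _),
      Q.mem_part_iff_part_eq_part (Finset.mem_univ _) (Finset.mem_univ _), key]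
  have parts_eq : ∀ P : SetPartition n, P.parts = Finset.univ.image P.part := by
    intro P
    ext B
    simp only [Finset.mem_image, Finset.mem_univ, true_and]
    constructor
    · intro hB
      obtain ⟨x, hx⟩ := P.nonempty_of_mem_parts hB
      exact ⟨x, P.part_eq_of_mem hB hx⟩
    · rintro ⟨x, rfl⟩
      exact P.part_mem.2 (Finset.mem_univ _)
  apply Finpartition.ext
  rw [parts_eq P, parts_eq Q]
  exact Finset.image_congr fun i _ => hp i

/-- Step back along `A` as long as possible: `hl` makes the predecessor unique and `hlt` makes the
walk stop. This serves both to build a partition from its arcs and to define the chains used in the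
count. -/
theorem exists_root (A : Fin n → Fin n → Prop) (hlt : ∀ i j, A i j → i < j)
    (hl : ∀ i j k, A i k → A j k → i = j) :
    ∃ r : Fin n → Fin n, (∀ i j, A i j → r j = r i) ∧ ∀ j, (∀ i, ¬ A i j) → r j = j := by
  classical
  let F : ∀ j : Fin n, (∀ i, i < j → Fin n) → Fin n := fun j ih =>
    if h : ∃ i, A i j then ih h.choose (hlt _ _ h.choose_spec) else j
  let r : Fin n → Fin n := WellFoundedLT.fix (motive := fun _ => Fin n) F
  have hrj : ∀ j, r j = if h : ∃ i, A i j then r h.choose else j := fun j =>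
    WellFoundedLT.fix_eq (motive := fun _ => Fin n) F j
  refine ⟨r, fun i j h => ?_, fun j h => ?_⟩
  · have h' : ∃ i, A i j := ⟨i, h⟩
    rw [hrj j, dif_pos h', hl _ _ _ h'.choose_spec h]
  · rw [hrj j, dif_neg (by simpa using h)]

/-- A relation contained in `<` which is functional in both directions is the arc relation of
a set partition. -/
theorem exists_setPartition_of_arcs (A : Fin n → Fin n → Prop) (hlt : ∀ i j, A i j → i < j)
    (hr : ∀ i j k, A i j → A i k → j = k) (hl : ∀ i j k, A i k → A j k → i = j) :
    ∃ P : SetPartition n, ∀ i j, IsArc P i j ↔ A i j := by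
  classical
  obtain ⟨r, hr1, hr2⟩ := exists_root A hlt hl
  have hle : ∀ j, r j ≤ j := by
    intro j
    induction j using WellFoundedLT.induction with
    | ind j ih =>
      by_cases h : ∃ i, A i j
      · obtain ⟨i, h⟩ := h
        rw [hr1 i j h]
        exact (ih i (hlt _ _ h)).trans (hlt _ _ h).le
      · rw [hr2 j (by simpa using h)]
  -- Elements with the same root lie on a single `A`-chain, so the smaller one has a successor that
  -- does not pass the larger one.
  have hnext : ∀ b a : Fin n, a < b → r a = r b → ∃ c, A a c ∧ c ≤ b := by
    intro b
    induction b using WellFoundedLT.induction with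
    | ind b ih =>
      intro a hab he
      by_cases h : ∃ p, A p b
      · obtain ⟨p, hp⟩ := h
        have hpb := hlt _ _ hp
        have hrp : r p = r a := by rw [he, hr1 p b hp]
        rcases lt_trichotomy a p with hap | rfl | hap
        · obtain ⟨c, hc, hcp⟩ := ih p hpb a hap hrp.symm
          exact ⟨c, hc, hcp.trans hpb.le⟩
        · exact ⟨b, hp, le_rfl⟩
        · obtain ⟨c, hc, hca⟩ := ih a hab p hap hrp
          rw [hr _ _ _ hc hp] at hca
          exact absurd hab (not_lt.2 hca)
      · have := hr2 b (by simpa using h)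
        have h2 := hle a
        rw [he, this] at h2
        exact absurd hab (not_lt.2 h2)
  let S : Setoid (Fin n) := Setoid.ker r
  refine ⟨Finpartition.ofSetoid S, ?_⟩
  have hS : ∀ i j, (Finpartition.ofSetoid S).part i = (Finpartition.ofSetoid S).part j ↔
      r i = r j := by
    intro i j
    rw [← Finpartition.mem_part_iff_part_eq_part _ (Finset.mem_univ _) (Finset.mem_univ _),
      Finpartition.mem_part_ofSetoid_iff_rel]
    exact ⟨fun h => (Setoid.ker_def.1 h).symm, fun h => Setoid.ker_def.2 h.symm⟩
  intro i j
  rw [isArc_iff]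
  simp only [hS, ne_eq]
  constructor
  · rintro ⟨h1, h2, h3⟩
    obtain ⟨c, hc, hcj⟩ := hnext j i h1 h2
    rcases hcj.eq_or_lt with rfl | hlt'
    · exact hc
    · exact absurd (hr1 _ _ hc) (h3 c (hlt _ _ hc) hlt')
  · intro h
    refine ⟨hlt _ _ h, (hr1 _ _ h).symm, fun l h1 h2 h3 => ?_⟩
    obtain ⟨c, hc, hcl⟩ := hnext l i h1 h3.symm
    rw [hr _ _ _ hc h] at hcl
    exact absurd h2 (not_lt.2 hcl)

open scoped Classical in
/-- The number of elements that are not the right end of an arc is the number of blocks. -/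
theorem card_starts (P : SetPartition n) :
    (Finset.univ.filter fun j => ∀ i, ¬ IsArc P i j).card = P.parts.card := by
  refine Finset.card_bij (fun j _ => P.part j) ?_ ?_ ?_
  · intro j _
    exact P.part_mem.2 (Finset.mem_univ _)
  · intro a ha b hb hab
    simp only [Finset.mem_filter, Finset.mem_univ, true_and] at ha hb
    by_contra hne
    rcases lt_or_gt_of_ne hne with h | h
    · obtain ⟨c, hc, -⟩ := exists_isArc_left h hab
      exact hb c hc
    · obtain ⟨c, hc, -⟩ := exists_isArc_left h hab.symm
      exact ha c hc
  · intro B hB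
    obtain ⟨m, hm, hmin⟩ := B.exists_min_image id (P.nonempty_of_mem_parts hB)
    have hmB := P.part_eq_of_mem hB hm
    refine ⟨m, ?_, hmB⟩
    simp only [Finset.mem_filter, Finset.mem_univ, true_and]
    intro i hi
    have : i ∈ B := by
      rw [← hmB, ← hi.part_eq]
      exact P.mem_part (Finset.mem_univ _)
    exact absurd hi.lt (not_lt.2 (hmin i this))

open scoped Classical in
theorem card_closers_add_card_parts (P : SetPartition n) :
    (Finset.univ.filter fun j => ∃ i, IsArc P i j).card + P.parts.card = n := by
  have h := Finset.card_filter_add_card_filter_not (s := (Finset.univ : Finset (Fin n)))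
    (fun j => ∃ i, IsArc P i j)
  simp only [not_exists, Finset.card_univ, Fintype.card_fin] at h
  rw [card_starts P] at h
  exact h

end Arcs

/-! ### Uniform description of the two arrangements -/

section Uniform

variable {n : ℕ}

/-- The first coordinate occurring in the hyperplane of the pair `i j`. -/
def src (t : Kind) (i : Fin n) : Fin n :=
  match t with
  | Kind.shi => i
  | Kind.ish => ⟨0, i.pos⟩

/-- The level of the hyperplane of the pair `i j`. -/
def lev (t : Kind) (i : Fin n) : ℝ :=
  match t with
  | Kind.shi => 1
  | Kind.ish => ((i : ℕ) : ℝ) + 1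

/-- For points whose coordinates are ordered decreasingly by `σ`, the inequality for the pair
`i j` becomes stronger as `key t σ i` decreases (and as the position of `j` increases). -/
def key (t : Kind) (σ : Equiv.Perm (Fin n)) (i : Fin n) : Fin n :=
  match t with
  | Kind.shi => σ i
  | Kind.ish => i

theorem edgeHyperplane_eq (t : Kind) (i j : Fin n) :
    edgeHyperplane t i j = {x | x (src t i) - x j = lev t i} := by
  cases t <;> rfl

theorem lev_pos (t : Kind) (i : Fin n) : 0 < lev t i := by
  cases t <;> simp only [lev] <;> positivity

theorem src_le (t : Kind) (i : Fin n) : src t i ≤ i := by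
  cases t
  · exact le_rfl
  · exact Fin.mk_le_of_le_val (Nat.zero_le _)

theorem key_injective (t : Kind) (σ : Equiv.Perm (Fin n)) : Function.Injective (key t σ) := by
  cases t
  · exact σ.injective
  · exact fun _ _ h => h

/-- If `key t σ i' ≤ key t σ i` then `src t i'` is not placed after `src t i`. -/
theorem src_le_of_key_le (t : Kind) (σ : Equiv.Perm (Fin n)) {i i' : Fin n}
    (h : key t σ i' ≤ key t σ i) : σ (src t i') ≤ σ (src t i) := by
  cases t
  · exact h
  · exact le_rfl

/-- The points on one side or the other of each hyperplane, as prescribed by `J`, whose coordinates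
are ordered decreasingly by `σ`. -/
def cell (t : Kind) (G : SimpleGraph (Fin n)) (σ : Equiv.Perm (Fin n)) (J : Fin n → Fin n → Prop) :
    Set (Fin n → ℝ) :=
  {x | (∀ i j, σ i < σ j → x j < x i) ∧ ∀ i j, i < j → G.Adj i j → σ (src t i) < σ j →
    (J i j → x (src t i) - x j < lev t i) ∧ (¬ J i j → lev t i < x (src t i) - x j)}

/-- The pairs cut off by `J` form a lower set for the order described at `key`. -/
def IsLower (t : Kind) (σ : Equiv.Perm (Fin n)) (J : Fin n → Fin n → Prop) : Prop :=
  ∀ i j i' j', J i' j' → key t σ i' ≤ key t σ i → σ j ≤ σ j' → J i j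

theorem le_of_forall_lt {σ : Equiv.Perm (Fin n)} {x : Fin n → ℝ}
    (hx : ∀ i j, σ i < σ j → x j ≤ x i) {i j : Fin n} (h : σ i ≤ σ j) : x j ≤ x i := by
  rcases h.eq_or_lt with h | h
  · rw [σ.injective h]
  · exact hx i j h

/-- The monotonicity behind the order on pairs. In the Shi case the first coordinate grows as its
position moves forward; in the Ish case it is fixed and the level drops. Weak inequalities suffice,
so the bound also applies on closures of cells. -/
theorem sub_lev_le (t : Kind) {σ : Equiv.Perm (Fin n)} {x : Fin n → ℝ}
    (hx : ∀ i j, σ i < σ j → x j ≤ x i) {i j i' j' : Fin n}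
    (hk : key t σ i' ≤ key t σ i) (hj : σ j ≤ σ j') :
    x (src t i) - x j - lev t i ≤ x (src t i') - x j' - lev t i' := by
  have h1 := le_of_forall_lt hx hj
  cases t
  · have h2 := le_of_forall_lt hx (show σ i' ≤ σ i from hk)
    simp only [src, lev]
    linarith
  · have h2 : ((i' : ℕ) : ℝ) ≤ ((i : ℕ) : ℝ) := by
      have : i' ≤ i := hk
      exact_mod_cast this
    simp only [src, lev]
    linarith

/-! ### Nonemptiness of the cells -/

/-- Add the points from left to right. The new value has to lie strictly between finitely many lower
and upper bounds, and the lower-set property is what makes every lower bound smaller than every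
upper bound. -/
theorem exists_seq_of_lower (K : ℕ → ℕ → Prop)
    (hK : ∀ p q p' q', K p' q' → p' ≤ p → q ≤ q' → K p q) (N : ℕ) :
    ∃ z : ℕ → ℝ, ∀ p q, p < q → q < N →
      z p < z q ∧ (K p q → z q < z p + 1) ∧ (¬ K p q → z p + 1 < z q) := by
  classical
  induction N with
  | zero => exact ⟨fun _ => 0, fun p q _ h => absurd h (Nat.not_lt_zero _)⟩
  | succ N ih =>
    obtain ⟨z, hz⟩ := ih
    have hmono : ∀ p q, p < N → q < N → p ≤ q → z p ≤ z q := by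
      intro p q _ hq h
      rcases h.eq_or_lt with rfl | h
      · exact le_rfl
      · exact (hz p q h hq).1.le
    obtain ⟨m, hlo, hhi⟩ := Order.exists_between_finsets
      ((Finset.range N).image z ∪ ((Finset.range N).filter fun p => ¬ K p N).image fun p => z p + 1)
      (((Finset.range N).filter fun p => K p N).image fun p => z p + 1) (by
        intro a ha b hb
        simp only [Finset.mem_union, Finset.mem_image, Finset.mem_filter, Finset.mem_range] at ha hb
        obtain ⟨q, ⟨hq, hKq⟩, rfl⟩ := hb
        rcases ha with ⟨p, hp, rfl⟩ | ⟨p, ⟨hp, hKp⟩, rfl⟩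
        · rcases lt_or_ge q p with h | h
          · exact (hz q p h hp).2.1 (hK _ _ _ _ hKq le_rfl hp.le)
          · have := hmono p q hp hq h
            linarith
        · have h : p < q := by
            by_contra h
            exact hKp (hK _ _ _ _ hKq (not_lt.1 h) le_rfl)
          have := (hz p q h hq).1
          linarith)
    refine ⟨Function.update z N m, fun p q hpq hq => ?_⟩
    have hpN : p < N := by omega
    rw [Function.update_of_ne hpN.ne]
    rcases (Nat.lt_succ_iff.1 hq).eq_or_lt with rfl | hq
    · rw [Function.update_self]
      refine ⟨hlo _ ?_, fun h => hhi _ ?_, fun h => hlo _ ?_⟩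
      · exact Finset.mem_union_left _ (Finset.mem_image_of_mem _ (Finset.mem_range.2 hpN))
      · exact Finset.mem_image_of_mem _ (Finset.mem_filter.2 ⟨Finset.mem_range.2 hpN, h⟩)
      · exact Finset.mem_union_right _
          (Finset.mem_image_of_mem _ (Finset.mem_filter.2 ⟨Finset.mem_range.2 hpN, h⟩))
    · rw [Function.update_of_ne hq.ne]
      exact hz p q hpq hq

theorem cell_shi_nonempty (G : SimpleGraph (Fin n)) (σ : Equiv.Perm (Fin n))
    {J : Fin n → Fin n → Prop} (hJ : IsLower Kind.shi σ J) : (cell Kind.shi G σ J).Nonempty := by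
  -- The relation `J`, read on positions and extended to all natural numbers as a generated lower
  -- set.
  obtain ⟨z, hz⟩ := exists_seq_of_lower
    (fun p q => ∃ i j, (σ i : ℕ) ≤ p ∧ q ≤ (σ j : ℕ) ∧ J i j)
    (by
      rintro p q p' q' ⟨i, j, h1, h2, h3⟩ hp hq
      exact ⟨i, j, h1.trans hp, hq.trans h2, h3⟩) n
  refine ⟨fun i => - z (σ i), fun i j hij => ?_, fun i j hij hG hσ => ?_⟩
  · have := (hz (σ i) (σ j) hij (σ j).2).1
    dsimp only
    linarith
  · obtain ⟨-, h1, h2⟩ := hz (σ i) (σ j) hσ (σ j).2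
    simp only [src, lev]
    refine ⟨fun h => ?_, fun h => ?_⟩
    · have := h1 ⟨i, j, le_rfl, le_rfl, h⟩
      linarith
    · have := h2 (by
        rintro ⟨i', j', h3, h4, h5⟩
        exact h (hJ _ _ _ _ h5 h3 h4))
      linarith

theorem cell_ish_nonempty (G : SimpleGraph (Fin n)) (σ : Equiv.Perm (Fin n))
    {J : Fin n → Fin n → Prop} (hJ : IsLower Kind.ish σ J) : (cell Kind.ish G σ J).Nonempty := by
  classical
  rcases n.eq_zero_or_pos with rfl | hn
  · exact ⟨0, fun i => i.elim0, fun i => i.elim0⟩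
  let o : Fin n := ⟨0, hn⟩
  -- For fixed `j` the pairs outside `J` form an initial segment in `i`, of length `m j`. So `x o -
  -- x j` should lie strictly between `m j` and `m j + 1`; the fractional part added in `y` enforces
  -- the order `σ`.
  let m : Fin n → ℕ := fun j => (Finset.univ.filter fun i => ¬ J i j).card
  have hm1 : ∀ i j, J i j → m j ≤ i := by
    intro i j h
    rw [← Fin.card_Iio i]
    refine Finset.card_le_card fun i' hi' => ?_
    simp only [Finset.mem_filter, Finset.mem_univ, true_and, Finset.mem_Iio] at hi' ⊢
    by_contra hlt
    exact hi' (hJ _ _ _ _ h (not_lt.1 hlt) le_rfl)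
  have hm2 : ∀ i j, ¬ J i j → (i : ℕ) + 1 ≤ m j := by
    intro i j h
    rw [← Fin.card_Iic i]
    refine Finset.card_le_card fun i' hi' => ?_
    simp only [Finset.mem_filter, Finset.mem_univ, true_and, Finset.mem_Iic] at hi' ⊢
    exact fun h' => h (hJ _ _ _ _ h' hi' le_rfl)
  have hm3 : ∀ j j', σ j ≤ σ j' → m j ≤ m j' := by
    intro j j' h
    refine Finset.card_le_card fun i' hi' => ?_
    simp only [Finset.mem_filter, Finset.mem_univ, true_and] at hi' ⊢
    exact fun h' => hi' (hJ _ _ _ _ h' le_rfl h)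
  have hn2 : (0 : ℝ) < n + 2 := by positivity
  have hfrac : ∀ j : Fin n, 0 < (((σ j : ℕ) : ℝ) + 1) / (n + 2) ∧
      (((σ j : ℕ) : ℝ) + 1) / (n + 2) < 1 := by
    intro j
    have : ((σ j : ℕ) : ℝ) < n := by exact_mod_cast (σ j).2
    refine ⟨by positivity, ?_⟩
    rw [div_lt_one hn2]
    linarith
  let y : Fin n → ℝ := fun j => (m j : ℝ) + (((σ j : ℕ) : ℝ) + 1) / (n + 2)
  have hypos : ∀ j, 0 < y j := by
    intro j
    have h0 : (0 : ℝ) ≤ m j := by positivity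
    have := (hfrac j).1
    simp only [y]
    linarith
  have hymono : ∀ i j, σ i < σ j → y i < y j := by
    intro i j h
    have h0 : (m i : ℝ) ≤ m j := by exact_mod_cast hm3 i j h.le
    have h1 : ((σ i : ℕ) : ℝ) < (σ j : ℕ) := by exact_mod_cast h
    have : (((σ i : ℕ) : ℝ) + 1) / (n + 2) < (((σ j : ℕ) : ℝ) + 1) / (n + 2) :=
      div_lt_div_of_pos_right (by linarith) hn2
    simp only [y]
    linarith
  -- Elements placed before `o` only have to respect the order, so differences of positions suffice
  -- for them.
  let x : Fin n → ℝ := fun j => if σ o < σ j then - y j else ((σ o : ℕ) : ℝ) - (σ j : ℕ)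
  have hx0 : x o = 0 := by simp [x]
  have hx1 : ∀ j, σ o < σ j → x j = - y j := fun j h => if_pos h
  have hx2 : ∀ j, ¬ σ o < σ j → x j = ((σ o : ℕ) : ℝ) - (σ j : ℕ) := fun j h => if_neg h
  refine ⟨x, fun i j hij => ?_, fun i j hij hG hσ => ?_⟩
  · by_cases hi : σ o < σ i
    · rw [hx1 i hi, hx1 j (hi.trans hij)]
      linarith [hymono i j hij]
    · rw [hx2 i hi]
      have h1 : ((σ i : ℕ) : ℝ) < (σ j : ℕ) := by exact_mod_cast hij
      by_cases hj : σ o < σ j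
      · rw [hx1 j hj]
        have : ((σ i : ℕ) : ℝ) ≤ (σ o : ℕ) := by exact_mod_cast not_lt.1 hi
        linarith [hypos j]
      · rw [hx2 j hj]
        linarith
  · change (_ → x o - x j < ((i : ℕ) : ℝ) + 1) ∧ (_ → ((i : ℕ) : ℝ) + 1 < x o - x j)
    rw [hx0, hx1 j hσ]
    have hf := hfrac j
    refine ⟨fun h => ?_, fun h => ?_⟩
    · have h1 : (m j : ℝ) ≤ (i : ℕ) := by exact_mod_cast hm1 i j h
      simp only [y]
      linarith
    · have h1 : ((i : ℕ) : ℝ) + 1 ≤ m j := by exact_mod_cast hm2 i j h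
      simp only [y]
      linarith

theorem cell_nonempty (t : Kind) (G : SimpleGraph (Fin n)) (σ : Equiv.Perm (Fin n))
    {J : Fin n → Fin n → Prop} (hJ : IsLower t σ J) : (cell t G σ J).Nonempty := by
  cases t
  · exact cell_shi_nonempty G σ hJ
  · exact cell_ish_nonempty G σ hJ

end Uniform

/-! ### Cells are regions -/

section Regions

variable {n : ℕ} {t : Kind} {G : SimpleGraph (Fin n)} {σ : Equiv.Perm (Fin n)}
  {J : Fin n → Fin n → Prop}

theorem mem_compl_arrangement {x : Fin n → ℝ} :
    x ∈ (⋃₀ arrangement t G)ᶜ ↔ (∀ i j, i < j → x i ≠ x j) ∧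
      ∀ i j, i < j → G.Adj i j → x (src t i) - x j ≠ lev t i := by
  simp only [Set.mem_compl_iff, Set.mem_sUnion, arrangement, cox, Set.mem_union, Set.mem_ofPred_eq,
    not_exists, not_and]
  constructor
  · intro h
    refine ⟨fun i j hij he => h _ (Or.inl ⟨i, j, hij, rfl⟩) ?_, fun i j hij hG he =>
      h _ (Or.inr ⟨i, j, hij, hG, rfl⟩) ?_⟩
    · simp [he]
    · rw [edgeHyperplane_eq]; exact he
  · rintro ⟨h1, h2⟩ H (⟨i, j, hij, rfl⟩ | ⟨i, j, hij, hG, rfl⟩) hx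
    · exact h1 i j hij (sub_eq_zero.1 hx)
    · rw [edgeHyperplane_eq] at hx
      exact h2 i j hij hG hx

theorem cell_subset_compl : cell t G σ J ⊆ (⋃₀ arrangement t G)ᶜ := by
  intro x hx
  rw [mem_compl_arrangement]
  refine ⟨fun i j hij => ?_, fun i j hij hG => ?_⟩
  · rcases lt_or_gt_of_ne (σ.injective.ne hij.ne) with h | h
    · exact (hx.1 _ _ h).ne'
    · exact (hx.1 _ _ h).ne
  · rcases lt_or_ge (σ (src t i)) (σ j) with h | h
    · by_cases hJ : J i j
      · exact ((hx.2 i j hij hG h).1 hJ).ne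
      · exact ((hx.2 i j hij hG h).2 hJ).ne'
    -- If `src t i` comes after `j`, the difference is at most `0 < lev t i`; this is why cells
    -- impose nothing on such pairs.
    · have h1 := le_of_forall_lt (fun i j h => (hx.1 i j h).le) h
      have h2 := lev_pos t i
      linarith

theorem convexCombo_lt {a b p q r s : ℝ} (ha : 0 ≤ a) (hb : 0 ≤ b) (hab : a + b = 1)
    (h1 : p < q) (h2 : r < s) : a * p + b * r < a * q + b * s := by
  rcases ha.eq_or_lt with rfl | ha
  · have : b = 1 := by linarith
    subst this
    linarith
  · have := mul_lt_mul_of_pos_left h1 ha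
    have := mul_le_mul_of_nonneg_left h2.le hb
    linarith

/-- The cell with the condition for the pair `a b` left out. -/
def cellExcept (t : Kind) (G : SimpleGraph (Fin n)) (σ : Equiv.Perm (Fin n))
    (J : Fin n → Fin n → Prop) (a b : Fin n) : Set (Fin n → ℝ) :=
  {x | (∀ i j, σ i < σ j → x j < x i) ∧ ∀ i j, ¬ (i = a ∧ j = b) → i < j → G.Adj i j →
    σ (src t i) < σ j →
    (J i j → x (src t i) - x j < lev t i) ∧ (¬ J i j → lev t i < x (src t i) - x j)}

theorem convex_cellExcept (a b : Fin n) : Convex ℝ (cellExcept t G σ J a b) := by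
  intro x hx y hy u v hu hv huv
  refine ⟨fun i j hij => ?_, fun i j hne hij hG hσ => ⟨fun h => ?_, fun h => ?_⟩⟩
  · simpa using convexCombo_lt hu hv huv (hx.1 i j hij) (hy.1 i j hij)
  · have := convexCombo_lt hu hv huv ((hx.2 i j hne hij hG hσ).1 h) ((hy.2 i j hne hij hG hσ).1 h)
    rw [← add_mul, huv, one_mul] at this
    simp only [Pi.add_apply, Pi.smul_apply, smul_eq_mul]
    linarith
  · have := convexCombo_lt hu hv huv ((hx.2 i j hne hij hG hσ).2 h) ((hy.2 i j hne hij hG hσ).2 h)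
    rw [← add_mul, huv, one_mul] at this
    simp only [Pi.add_apply, Pi.smul_apply, smul_eq_mul]
    linarith

theorem cell_subset_cellExcept (a b : Fin n) : cell t G σ J ⊆ cellExcept t G σ J a b :=
  fun _ hx => ⟨hx.1, fun i j _ => hx.2 i j⟩

/-- The pair `i i` carries no condition, so omitting it is harmless; convexity of cells is thereby a
special case. -/
theorem cell_eq_cellExcept (i : Fin n) : cell t G σ J = cellExcept t G σ J i i :=
  (cell_subset_cellExcept i i).antisymm fun _ hx =>
    ⟨hx.1, fun a b hab => hx.2 a b (fun h => hab.ne (h.1.trans h.2.symm)) hab⟩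

theorem convex_cell : Convex ℝ (cell t G σ J) := by
  rcases isEmpty_or_nonempty (Fin n) with h | ⟨⟨i⟩⟩
  · exact Set.Subsingleton.convex fun x _ y _ => Subsingleton.elim _ _
  · rw [cell_eq_cellExcept i]
    exact convex_cellExcept i i

theorem isOpen_cellExcept (a b : Fin n) : IsOpen (cellExcept t G σ J a b) := by
  unfold cellExcept
  simp only [Set.ofPred_and, Set.ofPred_forall]
  refine IsOpen.inter ?_ ?_
  · refine isOpen_iInter_of_finite fun i => isOpen_iInter_of_finite fun j =>
      isOpen_iInter_of_finite fun _ => isOpen_lt ?_ ?_ <;> fun_prop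
  · refine isOpen_iInter_of_finite fun i => isOpen_iInter_of_finite fun j =>
      isOpen_iInter_of_finite fun _ => isOpen_iInter_of_finite fun _ =>
      isOpen_iInter_of_finite fun _ => isOpen_iInter_of_finite fun _ => IsOpen.inter ?_ ?_
    · refine isOpen_iInter_of_finite fun _ => isOpen_lt ?_ ?_ <;> fun_prop
    · refine isOpen_iInter_of_finite fun _ => isOpen_lt ?_ ?_ <;> fun_prop

theorem lt_of_isPreconnected {X : Type*} [TopologicalSpace X] {C : Set X} (hC : IsPreconnected C)
    {f : X → ℝ} (hf : Continuous f) {c : ℝ} (hne : ∀ z ∈ C, f z ≠ c) {x y : X} (hx : x ∈ C)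
    (hy : y ∈ C) (h : f x < c) : f y < c := by
  by_contra hcon
  obtain ⟨z, hz, hz'⟩ := hC.intermediate_value hx hy hf.continuousOn ⟨h.le, not_lt.1 hcon⟩
  exact hne z hz hz'

/-- No defining linear form attains its critical value on a component, so its side is constant
there; convexity gives the other inclusion. -/
theorem connectedComponentIn_eq_cell {x : Fin n → ℝ} (hx : x ∈ cell t G σ J) :
    connectedComponentIn (⋃₀ arrangement t G)ᶜ x = cell t G σ J := by
  apply Set.Subset.antisymm
  · intro y hy
    have hC : IsPreconnected (connectedComponentIn (⋃₀ arrangement t G)ᶜ x) :=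
      isPreconnected_connectedComponentIn
    have hsub := connectedComponentIn_subset (⋃₀ arrangement t G)ᶜ x
    have hxC := mem_connectedComponentIn (cell_subset_compl hx)
    refine ⟨fun i j hij => ?_, fun i j hij hG hσ => ⟨fun h => ?_, fun h => ?_⟩⟩
    · have := lt_of_isPreconnected hC (f := fun z => z j - z i) (by fun_prop) (c := 0) (fun z hz => by
        have h1 := (mem_compl_arrangement.1 (hsub hz)).1
        intro he
        rcases lt_or_gt_of_ne (show i ≠ j by rintro rfl; exact hij.ne rfl) with h | h
        · exact h1 i j h (by linarith)
        · exact h1 j i h (by linarith)) hxC hy (by linarith [hx.1 i j hij])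
      linarith
    · exact lt_of_isPreconnected hC (f := fun z => z (src t i) - z j) (by fun_prop)
        (fun z hz => (mem_compl_arrangement.1 (hsub hz)).2 i j hij hG) hxC hy
        ((hx.2 i j hij hG hσ).1 h)
    · have := lt_of_isPreconnected hC (f := fun z => - (z (src t i) - z j)) (by fun_prop)
        (c := - lev t i)
        (fun z hz he => (mem_compl_arrangement.1 (hsub hz)).2 i j hij hG (neg_injective he)) hxC hy
        (neg_lt_neg ((hx.2 i j hij hG hσ).2 h))
      linarith
  · exact convex_cell.isPreconnected.subset_connectedComponentIn hx cell_subset_compl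

theorem cell_mem_regions (h : (cell t G σ J).Nonempty) :
    cell t G σ J ∈ regions (arrangement t G) := by
  obtain ⟨x, hx⟩ := h
  exact ⟨x, cell_subset_compl hx, (connectedComponentIn_eq_cell hx).symm⟩

/-! ### Ceilings of cells -/

theorem zero_notMem_edgeHyperplane (i j : Fin n) : (0 : Fin n → ℝ) ∉ edgeHyperplane t i j := by
  rw [edgeHyperplane_eq]
  simpa using (lev_pos t i).ne

/-- Test points suffice: `-lev t i` in coordinate `j` determines `j`, and in the Ish case also the
level. In the Shi case the unit vector at `i` determines `i`. -/
theorem edgeHyperplane_subset {i j i' j' : Fin n} (hij : i < j) (hij' : i' < j')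
    (h : edgeHyperplane t i j ⊆ edgeHyperplane t i' j') : i = i' ∧ j = j' := by
  have hs : src t i ≠ j := ((src_le t i).trans_lt hij).ne
  have hs' : src t i' ≠ j' := ((src_le t i').trans_lt hij').ne
  rw [edgeHyperplane_eq, edgeHyperplane_eq] at h
  have h1 : (Pi.single j (-lev t i) : Fin n → ℝ) ∈ {x | x (src t i') - x j' = lev t i'} :=
    h (by simp [hs])
  have hp := lev_pos t i
  have hp' := lev_pos t i'
  have hj : j = j' := by
    by_contra hne
    simp only [Set.mem_ofPred_eq, Pi.single_apply, if_neg (Ne.symm hne)] at h1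
    split_ifs at h1 <;> linarith
  subst hj
  refine ⟨?_, rfl⟩
  cases t
  · have h2 : (Pi.single i 1 : Fin n → ℝ) ∈ {x | x (src Kind.shi i') - x j = lev Kind.shi i'} :=
      h (by simp [src, lev, hij.ne'])
    simp only [src, lev, Set.mem_ofPred_eq, Pi.single_apply, if_neg hij.ne', sub_zero] at h2
    by_contra hne
    rw [if_neg (Ne.symm hne)] at h2
    exact zero_ne_one h2
  · simp only [Set.mem_ofPred_eq, Pi.single_apply, if_neg hs', if_true, lev] at h1
    have h2 : ((i : ℕ) : ℝ) = (i' : ℕ) := by linarith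
    exact Fin.ext (by exact_mod_cast h2)

theorem edgeHyperplane_mem_arrangement {i j : Fin n} (hij : i < j) :
    edgeHyperplane t i j ∈ arrangement t G ↔ G.Adj i j := by
  refine ⟨?_, fun h => Or.inr ⟨i, j, hij, h, rfl⟩⟩
  rintro (⟨a, b, -, h⟩ | ⟨a, b, hab, hG, h⟩)
  · exact absurd (h ▸ (by simp : (0 : Fin n → ℝ) ∈ {x : Fin n → ℝ | x a - x b = 0}))
      (zero_notMem_edgeHyperplane i j)
  · obtain ⟨rfl, rfl⟩ := edgeHyperplane_subset hij hab h.subset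
    exact hG

theorem closure_cell_subset :
    closure (cell t G σ J) ⊆ {x | (∀ i j, σ i < σ j → x j ≤ x i) ∧ ∀ i j, i < j → G.Adj i j →
      σ (src t i) < σ j → J i j → x (src t i) - x j ≤ lev t i} := by
  refine closure_minimal
    (fun x hx => ⟨fun i j h => (hx.1 i j h).le, fun i j h1 h2 h3 h4 => ((hx.2 i j h1 h2 h3).1 h4).le⟩) ?_
  simp only [Set.ofPred_and, Set.ofPred_forall]
  refine IsClosed.inter ?_ ?_
  · refine isClosed_iInter fun i => isClosed_iInter fun j => isClosed_iInter fun _ =>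
      isClosed_le ?_ ?_ <;> fun_prop
  · refine isClosed_iInter fun i => isClosed_iInter fun j => isClosed_iInter fun _ =>
      isClosed_iInter fun _ => isClosed_iInter fun _ => isClosed_iInter fun _ =>
      isClosed_le ?_ ?_ <;> fun_prop

theorem affineSpan_subset {a b : Fin n} {c : ℝ} {F : Set (Fin n → ℝ)}
    (hF : F ⊆ {x | x a - x b = c}) : (affineSpan ℝ F : Set (Fin n → ℝ)) ⊆ {x | x a - x b = c} := by
  intro x hx
  refine affineSpan_induction (p := fun x => x ∈ {x : Fin n → ℝ | x a - x b = c}) hx hF ?_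
  intro s u v w hu hv hw
  simp only [Set.mem_ofPred_eq] at hu hv hw ⊢
  simp only [vsub_eq_sub, vadd_eq_add, Pi.add_apply, Pi.smul_apply, Pi.sub_apply, smul_eq_mul]
  linear_combination s * hu - s * hv + hw

/-- A relatively open piece of a hyperplane `x_a - x_b = c` spans it. -/
theorem affineSpan_eq_of_isOpen {a b : Fin n} {c : ℝ} {F O : Set (Fin n → ℝ)} (hO : IsOpen O)
    {z : Fin n → ℝ} (hz : z ∈ O) (hzc : z a - z b = c) (hF : F ⊆ {x | x a - x b = c})
    (hOF : O ∩ {x | x a - x b = c} ⊆ F) : (affineSpan ℝ F : Set (Fin n → ℝ)) = {x | x a - x b = c} := by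
  apply Set.Subset.antisymm
  · exact affineSpan_subset hF
  · intro y hy
    have hcont : Continuous fun ε : ℝ => AffineMap.lineMap z y ε := AffineMap.lineMap_continuous
    have h0 : ∀ᶠ ε in nhdsWithin (0 : ℝ) (Set.Ioi 0), AffineMap.lineMap z y ε ∈ O :=
      (hcont.tendsto' 0 z (by simp)).eventually (hO.mem_nhds hz) |>.filter_mono nhdsWithin_le_nhds
    obtain ⟨ε, hεO, hε⟩ := (h0.and self_mem_nhdsWithin).exists
    have hε0 : (ε : ℝ) ≠ 0 := (show (0 : ℝ) < ε from hε).ne'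
    have hwH : (AffineMap.lineMap z y ε : Fin n → ℝ) ∈ {x : Fin n → ℝ | x a - x b = c} := by
      simp only [Set.mem_ofPred_eq] at hy ⊢
      simp only [AffineMap.lineMap_apply, vsub_eq_sub, vadd_eq_add, Pi.add_apply, Pi.smul_apply,
        Pi.sub_apply, smul_eq_mul]
      linear_combination ε * hy + (1 - ε) * hzc
    -- The point at parameter `ε` lies in `O` and on the hyperplane, hence in `F`; stretching from
    -- `z` by `ε⁻¹` recovers `y`.
    have hy' : y = AffineMap.lineMap z (AffineMap.lineMap z y ε : Fin n → ℝ) ε⁻¹ := by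
      ext i
      simp only [AffineMap.lineMap_apply, vsub_eq_sub, vadd_eq_add, Pi.add_apply, Pi.smul_apply,
        Pi.sub_apply, smul_eq_mul]
      field_simp
      ring
    rw [hy']
    exact AffineMap.lineMap_mem _ (subset_affineSpan ℝ F (hOF ⟨hz, hzc⟩))
      (subset_affineSpan ℝ F (hOF ⟨hεO, hwH⟩))

/-- If `J` and `J'` differ only in the pair `a b`, then the hyperplane of `a b` is a ceiling of the
cell of `J`. -/
theorem isCeiling_cell {J' : Fin n → Fin n → Prop} {a b : Fin n} (hab : a < b) (hG : G.Adj a b)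
    (hσ : σ (src t a) < σ b) (hJ : (cell t G σ J).Nonempty) (hJ' : (cell t G σ J').Nonempty)
    (hJab : J a b) (hJab' : ¬ J' a b) (h : ∀ i j, ¬ (i = a ∧ j = b) → (J i j ↔ J' i j)) :
    IsCeiling (arrangement t G) (cell t G σ J) (edgeHyperplane t a b) := by
  obtain ⟨x, hx⟩ := hJ
  obtain ⟨x', hx'⟩ := hJ'
  have hxlt := (hx.2 a b hab hG hσ).1 hJab
  have hO' : cellExcept t G σ J' a b = cellExcept t G σ J a b := by
    ext y
    refine and_congr_right fun _ => forall_congr' fun i => forall_congr' fun j => ?_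
    refine forall_congr' fun hne => ?_
    rw [h i j hne]
  have hOx := cell_subset_cellExcept a b hx
  have hOx' : x' ∈ cellExcept t G σ J a b := hO' ▸ cell_subset_cellExcept a b hx'
  have hmem : ∀ y ∈ cellExcept t G σ J a b, y (src t a) - y b < lev t a → y ∈ cell t G σ J := by
    intro y hy hlt
    refine ⟨hy.1, fun i j => ?_⟩
    by_cases hij : i = a ∧ j = b
    · obtain ⟨rfl, rfl⟩ := hij
      exact fun _ _ _ => ⟨fun _ => hlt, fun hn => absurd hJab hn⟩
    · exact hy.2 i j hij
  -- The two cells lie on opposite sides of the hyperplane inside one convex open set, so that set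
  -- meets the hyperplane.
  obtain ⟨z, hz, hzc⟩ := (convex_cellExcept a b).isPreconnected.intermediate_value hOx hOx'
    (f := fun y => y (src t a) - y b) (by fun_prop)
    ⟨hxlt.le, ((hx'.2 a b hab hG hσ).2 hJab').le⟩
  have hOH : cellExcept t G σ J a b ∩ {y | y (src t a) - y b = lev t a} ⊆ closure (cell t G σ J) := by
    rintro y ⟨hy, hyc⟩
    -- A point of the hyperplane inside the open set is a limit of points of the cell along the
    -- segment from `x`.
    have hseg : openSegment ℝ x y ⊆ cell t G σ J := by
      rintro w ⟨u, v, hu, hv, huv, rfl⟩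
      refine hmem _ (convex_cellExcept a b hOx hy hu.le hv.le huv) ?_
      simp only [Set.mem_ofPred_eq] at hyc
      simp only [Pi.add_apply, Pi.smul_apply, smul_eq_mul]
      have := mul_lt_mul_of_pos_left hxlt hu
      have hv' : v = 1 - u := by linarith
      subst hv'
      linear_combination this + (1 - u) * hyc
    refine closure_mono hseg ?_
    rw [closure_openSegment]
    exact right_mem_segment ℝ x y
  refine ⟨⟨(edgeHyperplane_mem_arrangement hab).2 hG, closure (cell t G σ J) ∩ edgeHyperplane t a b,
    ⟨?_, {edgeHyperplane t a b}, ?_, by simp⟩, ?_⟩, zero_notMem_edgeHyperplane a b, ?_⟩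
  · rw [edgeHyperplane_eq]
    exact ⟨z, hOH ⟨hz, hzc⟩, hzc⟩
  · exact Set.singleton_subset_iff.2 ((edgeHyperplane_mem_arrangement hab).2 hG)
  · rw [edgeHyperplane_eq]
    exact affineSpan_eq_of_isOpen (isOpen_cellExcept a b) hz hzc Set.inter_subset_right
      fun y hy => ⟨hOH hy, hy.2⟩
  · intro y hy
    rw [Set.disjoint_left, edgeHyperplane_eq]
    rintro w ⟨u, v, hu, hv, huv, rfl⟩ hw
    have h1 := (hy.2 a b hab hG hσ).1 hJab
    have := convexCombo_lt hu hv huv (lev_pos t a) h1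
    rw [← add_mul, huv, one_mul] at this
    simp only [Set.mem_ofPred_eq, smul_zero, zero_add, Pi.smul_apply, smul_eq_mul] at hw
    linarith

theorem isWall_subset_closure {A : Set (Set (Fin n → ℝ))} {R H : Set (Fin n → ℝ)}
    (h : IsWall A R H) : ∃ F ⊆ closure R ∩ H, F.Nonempty ∧
      (affineSpan ℝ F : Set (Fin n → ℝ)) = H := by
  obtain ⟨-, F, ⟨hF, S, -, hFS⟩, hspan⟩ := h
  refine ⟨F, fun x hx => ⟨?_, ?_⟩, hF, hspan⟩
  · rw [hFS] at hx
    exact hx.1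
  · rw [← hspan]
    exact subset_affineSpan ℝ F hx

/-- A ceiling of a cell belongs to a maximal pair of `J`. -/
theorem IsCeiling.maximal (hJ : (cell t G σ J).Nonempty) {i j : Fin n} (hij : i < j)
    (h : IsCeiling (arrangement t G) (cell t G σ J) (edgeHyperplane t i j)) :
    G.Adj i j ∧ σ (src t i) < σ j ∧ J i j ∧ ∀ i' j', i' < j' → G.Adj i' j' → σ (src t i') < σ j' →
      J i' j' → key t σ i' ≤ key t σ i → σ j ≤ σ j' → i = i' ∧ j = j' := by
  have hG : G.Adj i j := (edgeHyperplane_mem_arrangement hij).1 h.1.1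
  obtain ⟨F, hF, ⟨y, hy⟩, hspan⟩ := isWall_subset_closure h.1
  have hσ : σ (src t i) < σ j := by
    by_contra hcon
    have h1 := le_of_forall_lt (closure_cell_subset (hF hy).1).1 (not_lt.1 hcon)
    have h2 := (hF hy).2
    rw [edgeHyperplane_eq, Set.mem_ofPred_eq] at h2
    linarith [lev_pos t i]
  have hJij : J i j := by
    by_contra hcon
    obtain ⟨x, hx⟩ := hJ
    have hlt := (hx.2 i j hij hG hσ).2 hcon
    have hpos : 0 < x (src t i) - x j := (lev_pos t i).trans hlt
    -- Beyond the hyperplane, the segment from the origin to `x` crosses it at this ratio.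
    refine Set.disjoint_left.1 (h.2.2 x hx)
      ⟨1 - lev t i / (x (src t i) - x j), lev t i / (x (src t i) - x j), ?_, ?_, by ring, rfl⟩ ?_
    · rw [sub_nonneg, div_le_one hpos]
      exact hlt.le
    · exact div_nonneg (lev_pos t i).le hpos.le
    · rw [edgeHyperplane_eq]
      simp only [Set.mem_ofPred_eq, smul_zero, zero_add, Pi.smul_apply, smul_eq_mul, ← mul_sub]
      exact div_mul_cancel₀ _ hpos.ne'
  refine ⟨hG, hσ, hJij, fun i' j' hij' hG' hσ' hJ' hk hj => edgeHyperplane_subset (t := t) hij hij' ?_⟩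
  rw [← hspan]
  -- On `F` the defect of `i j` is zero, and it is at most the defect of the stronger pair, which is
  -- at most zero on the closure. So both vanish and `F` lies in both hyperplanes.
  have hsub : F ⊆ edgeHyperplane t i' j' := by
    intro x hx
    have h1 := closure_cell_subset (hF hx).1
    have h2 := (hF hx).2
    have h3 := sub_lev_le t h1.1 hk hj
    have h4 := h1.2 i' j' hij' hG' hσ' hJ'
    rw [edgeHyperplane_eq, Set.mem_ofPred_eq] at h2 ⊢
    linarith
  rw [edgeHyperplane_eq] at hsub ⊢
  exact affineSpan_subset hsub

end Regions

/-! ### Regions and compatible pairs of a permutation and a partition -/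

section Compatible

variable {n : ℕ} {t : Kind} {G : SimpleGraph (Fin n)} {σ : Equiv.Perm (Fin n)} {P : SetPartition n}

/-- The arcs of `P` are pairwise incomparable pairs whose hyperplanes meet the chamber of `σ`. -/
def Compatible (t : Kind) (σ : Equiv.Perm (Fin n)) (P : SetPartition n) : Prop :=
  (∀ i j, IsArc P i j → σ (src t i) < σ j) ∧
    ∀ i j i' j', IsArc P i j → IsArc P i' j' → key t σ i < key t σ i' → σ j < σ j'

/-- The lower set of pairs generated by the arcs of `P`. -/
def Below (t : Kind) (σ : Equiv.Perm (Fin n)) (P : SetPartition n) (i j : Fin n) : Prop :=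
  ∃ a b, IsArc P a b ∧ key t σ a ≤ key t σ i ∧ σ j ≤ σ b

/-- The region attached to a permutation and a partition. -/
def regionOf (t : Kind) (G : SimpleGraph (Fin n)) (σ : Equiv.Perm (Fin n)) (P : SetPartition n) :
    Set (Fin n → ℝ) :=
  cell t G σ (Below t σ P)

theorem isLower_below : IsLower t σ (Below t σ P) := by
  rintro i j i' j' ⟨a, b, h, h1, h2⟩ h3 h4
  exact ⟨a, b, h, h1.trans h3, h4.trans h2⟩

theorem regionOf_nonempty : (regionOf t G σ P).Nonempty := cell_nonempty t G σ isLower_below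

theorem regionOf_mem_regions : regionOf t G σ P ∈ regions (arrangement t G) :=
  cell_mem_regions regionOf_nonempty

theorem Compatible.eq_of_le (h : Compatible t σ P) {i j i' j' : Fin n} (ha : IsArc P i j)
    (ha' : IsArc P i' j') (hk : key t σ i' ≤ key t σ i) (hj : σ j ≤ σ j') : i = i' ∧ j = j' := by
  rcases hk.eq_or_lt with hk | hk
  · obtain rfl := key_injective t σ hk
    exact ⟨rfl, ha.right_unique ha'⟩
  · exact absurd (h.2 _ _ _ _ ha' ha hk) (not_lt.2 hj)

theorem isCeiling_regionOf_iff (h : Compatible t σ P) (hG : IsGPartition G P) {i j : Fin n}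
    (hij : i < j) :
    IsCeiling (arrangement t G) (regionOf t G σ P) (edgeHyperplane t i j) ↔ IsArc P i j := by
  constructor
  · intro hc
    obtain ⟨-, -, ⟨a, b, hab, h1, h2⟩, hmax⟩ := hc.maximal regionOf_nonempty hij
    obtain ⟨rfl, rfl⟩ := hmax a b hab.lt (hG _ _ hab) (h.1 _ _ hab) ⟨a, b, hab, le_rfl, le_rfl⟩ h1 h2
    exact hab
  · intro ha
    refine isCeiling_cell hij (hG _ _ ha) (h.1 _ _ ha) regionOf_nonempty
      -- Discard all pairs at least as strong as `i j`. The rest is still a lower set, and as the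
      -- arcs form an antichain only `i j` itself is lost.
      (J' := fun c d => Below t σ P c d ∧ ¬ (key t σ c ≤ key t σ i ∧ σ j ≤ σ d))
      (cell_nonempty t G σ ?_) ⟨i, j, ha, le_rfl, le_rfl⟩ (fun hcon => hcon.2 ⟨le_rfl, le_rfl⟩) ?_
    · rintro c d c' d' ⟨h1, h2⟩ h3 h4
      exact ⟨isLower_below _ _ _ _ h1 h3 h4, fun h5 => h2 ⟨h3.trans h5.1, h5.2.trans h4⟩⟩
    · intro c d hne
      refine ⟨fun hb => ⟨hb, fun h5 => hne ?_⟩, fun hb => hb.1⟩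
      obtain ⟨a, b, hab, h1, h2⟩ := hb
      obtain ⟨rfl, rfl⟩ := h.eq_of_le ha hab (h1.trans h5.1) (h5.2.trans h2)
      exact ⟨key_injective t σ (h5.1.antisymm h1), σ.injective (h2.antisymm h5.2)⟩

theorem isCeilingPartition_regionOf (h : Compatible t σ P) (hG : IsGPartition G P) :
    IsCeilingPartition t G (regionOf t G σ P) P := fun _ _ =>
  ⟨fun ha => ⟨ha.lt, (isCeiling_regionOf_iff h hG ha.lt).2 ha⟩,
    fun hc => (isCeiling_regionOf_iff h hG hc.1).1 hc.2⟩

theorem IsCeilingPartition.unique {R : Set (Fin n → ℝ)} {Q : SetPartition n}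
    (hP : IsCeilingPartition t G R P) (hQ : IsCeilingPartition t G R Q) : P = Q :=
  setPartition_ext fun i j => (hP i j).trans (hQ i j).symm

theorem IsCeilingPartition.isGPartition {R : Set (Fin n → ℝ)} (hP : IsCeilingPartition t G R P) :
    IsGPartition G P := fun _ _ ha =>
  (edgeHyperplane_mem_arrangement ha.lt).1 ((hP _ _).1 ha).2.1.1

theorem perm_eq_of_regionOf_eq {τ : Equiv.Perm (Fin n)} {Q : SetPartition n}
    (h : regionOf t G σ P = regionOf t G τ Q) : σ = τ := by
  obtain ⟨x, hx⟩ : (regionOf t G σ P).Nonempty := regionOf_nonempty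
  have hx' := h ▸ hx
  have hmono : StrictMono fun p => τ (σ.symm p) := by
    intro p q hpq
    have h1 := hx.1 (σ.symm p) (σ.symm q) (by simpa using hpq)
    by_contra hcon
    exact absurd h1 (not_lt.2 (le_of_forall_lt (fun i j h => (hx'.1 i j h).le) (not_lt.1 hcon)))
  have := (hmono.range_inj strictMono_id).1 (by
    rw [Set.range_id]
    exact (σ.symm.trans τ).surjective.range_eq)
  ext i
  have h2 := congrFun this (σ i)
  simp only [Equiv.symm_apply_apply, id] at h2
  rw [h2]

theorem exists_perm_of_injective {x : Fin n → ℝ} (hx : Function.Injective x) :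
    ∃ σ : Equiv.Perm (Fin n), ∀ i j, σ i < σ j → x j < x i := by
  refine ⟨(Tuple.sort (-x)).symm, fun i j hij => ?_⟩
  have h := Tuple.monotone_sort (-x) hij.le
  simp only [Function.comp_apply, Equiv.apply_symm_apply, Pi.neg_apply, neg_le_neg_iff] at h
  exact h.lt_of_ne fun he => hij.ne (by rw [hx he])

/-- Sort a point of the region by `σ`, let `I` be the inequalities it satisfies and `A` the maximal
ones. Pairs sharing an end are comparable, so `A` is the arc relation of a partition, and it
generates `I`. -/
theorem exists_eq_regionOf {R : Set (Fin n → ℝ)} (hR : R ∈ regions (arrangement t G)) :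
    ∃ σ P, Compatible t σ P ∧ IsGPartition G P ∧ R = regionOf t G σ P := by
  classical
  obtain ⟨x, hx, rfl⟩ := hR
  obtain ⟨hx1, hx2⟩ := mem_compl_arrangement.1 hx
  obtain ⟨σ, hσ⟩ := exists_perm_of_injective (x := x) (fun i j he => by
    by_contra hne
    rcases lt_or_gt_of_ne hne with h | h
    · exact hx1 i j h he
    · exact hx1 j i h he.symm)
  let I : Fin n → Fin n → Prop := fun a b =>
    a < b ∧ G.Adj a b ∧ σ (src t a) < σ b ∧ x (src t a) - x b < lev t a
  let A : Fin n → Fin n → Prop := fun a b =>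
    I a b ∧ ∀ a' b', I a' b' → key t σ a' ≤ key t σ a → σ b ≤ σ b' → a = a' ∧ b = b'
  have hA : ∀ i j, I i j → ∃ a b, A a b ∧ key t σ a ≤ key t σ i ∧ σ j ≤ σ b := by
    intro i j hij
    -- Passing to a strictly stronger pair increases this integer, so a maximiser is a maximal pair.
    obtain ⟨⟨a, b⟩, hab, hmax⟩ := ((Finset.univ : Finset (Fin n × Fin n)).filter fun p =>
      I p.1 p.2 ∧ key t σ p.1 ≤ key t σ i ∧ σ j ≤ σ p.2).exists_max_image
      (fun p => ((σ p.2 : ℕ) : ℤ) - (key t σ p.1 : ℕ)) ⟨(i, j), by simpa using hij⟩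
    simp only [Finset.mem_filter, Finset.mem_univ, true_and, Prod.forall] at hab hmax
    refine ⟨a, b, ⟨hab.1, fun a' b' hI hk hb => ?_⟩, hab.2⟩
    have h1 := hmax a' b' ⟨hI, hk.trans hab.2.1, hab.2.2.trans hb⟩
    have h2 : (key t σ a' : ℕ) ≤ key t σ a := hk
    have h3 : (σ b : ℕ) ≤ σ b' := hb
    exact ⟨key_injective t σ (Fin.ext (by omega)), σ.injective (Fin.ext (by omega))⟩
  obtain ⟨P, hP⟩ := exists_setPartition_of_arcs A (fun i j h => h.1.1)
    (fun i j k h h' => by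
      rcases le_total (σ j) (σ k) with hjk | hjk
      · exact (h.2 i k h'.1 le_rfl hjk).2
      · exact (h'.2 i j h.1 le_rfl hjk).2.symm)
    (fun i j k h h' => by
      rcases le_total (key t σ i) (key t σ j) with hjk | hjk
      · exact (h'.2 i k h.1 hjk le_rfl).1.symm
      · exact (h.2 j k h'.1 hjk le_rfl).1)
  refine ⟨σ, P, ⟨fun i j h => ((hP i j).1 h).1.2.2.1, fun i j i' j' h h' hk => ?_⟩,
    fun i j h => ((hP i j).1 h).1.2.1, connectedComponentIn_eq_cell ⟨hσ, fun i j hij hG hlt => ?_⟩⟩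
  · by_contra hcon
    have := ((hP _ _).1 h').2 i j ((hP _ _).1 h).1 hk.le (not_lt.1 hcon)
    rw [this.1] at hk
    exact lt_irrefl _ hk
  · refine ⟨?_, fun hn => ?_⟩
    · rintro ⟨a, b, hab, hk, hb⟩
      have h1 := ((hP _ _).1 hab).1.2.2.2
      have h2 := sub_lev_le t (fun i j h => (hσ i j h).le) hk hb
      linarith
    · by_contra hcon
      obtain ⟨a, b, hab, h1, h2⟩ := hA i j
        ⟨hij, hG, hlt, lt_of_le_of_ne (not_lt.1 hcon) (hx2 i j hij hG)⟩
      exact hn ⟨a, b, (hP _ _).2 hab, h1, h2⟩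

theorem regions_finite : (regions (arrangement t G)).Finite := by
  refine (Set.finite_range fun p : Equiv.Perm (Fin n) × SetPartition n =>
    regionOf t G p.1 p.2).subset fun R hR => ?_
  obtain ⟨σ, P, -, -, rfl⟩ := exists_eq_regionOf hR
  exact ⟨(σ, P), rfl⟩

theorem numCeilings_add_card_parts {R : Set (Fin n → ℝ)} (h : IsCeilingPartition t G R P) :
    numCeilings (arrangement t G) R + P.parts.card = n := by
  classical
  have h1 : {H | IsCeiling (arrangement t G) R H} =
      (fun p : Fin n × Fin n => edgeHyperplane t p.1 p.2) '' {p | IsArc P p.1 p.2} := by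
    ext H
    simp only [Set.mem_image, Set.mem_ofPred_eq, Prod.exists]
    constructor
    · intro hH
      rcases hH.1.1 with ⟨i, j, -, rfl⟩ | ⟨i, j, hij, -, rfl⟩
      · exact absurd (by simp) hH.2.1
      · exact ⟨i, j, (h i j).2 ⟨hij, hH⟩, rfl⟩
    · rintro ⟨i, j, ha, rfl⟩
      exact ((h i j).1 ha).2
  have h2 : (Prod.snd '' {p : Fin n × Fin n | IsArc P p.1 p.2}) =
      ((Finset.univ.filter fun j => ∃ i, IsArc P i j : Finset (Fin n)) : Set (Fin n)) := by
    ext j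
    simp
  rw [numCeilings, h1, Set.InjOn.ncard_image, ← Set.InjOn.ncard_image (f := Prod.snd), h2,
    Set.ncard_coe_finset]
  · convert card_closers_add_card_parts P
  · rintro ⟨i, j⟩ h ⟨i', j'⟩ h' he
    obtain rfl : j = j' := he
    obtain rfl := IsArc.left_unique h h'
    rfl
  · rintro ⟨i, j⟩ h ⟨i', j'⟩ h' he
    obtain ⟨rfl, rfl⟩ := edgeHyperplane_subset (IsArc.lt h) (IsArc.lt h') (Eq.subset he)
    rfl

end Compatible

/-! ### Degrees of freedom -/

section Freedom

variable {n : ℕ} {t : Kind} {G : SimpleGraph (Fin n)} {σ : Equiv.Perm (Fin n)} {P : SetPartition n}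

/-- The gap just before the position of `j` is spanned by an arc. -/
def Covered (t : Kind) (σ : Equiv.Perm (Fin n)) (P : SetPartition n) (j : Fin n) : Prop :=
  ∃ a b, IsArc P a b ∧ σ (src t a) < σ j ∧ σ j ≤ σ b

theorem nonneg_of_forall_nat_add_pos {a b : ℝ} (h : ∀ m : ℕ, 0 < a + m * b) : 0 ≤ b := by
  by_contra hb
  obtain ⟨m, hm⟩ := exists_nat_gt (a / -b)
  rw [div_lt_iff₀ (by linarith)] at hm
  linarith [h m]

theorem nsmul_add_mem {v x : Fin n → ℝ} {R : Set (Fin n → ℝ)} (hv : v ∈ recessionCone R)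
    (hx : x ∈ R) (m : ℕ) : m • v + x ∈ R := by
  induction m with
  | zero => simpa using hx
  | succ m ih =>
    rw [succ_nsmul', add_assoc]
    exact hv _ ih

theorem recessionCone_antitone {v : Fin n → ℝ} (hv : v ∈ recessionCone (regionOf t G σ P))
    {i j : Fin n} (hij : σ i < σ j) : v j ≤ v i := by
  obtain ⟨x, hx⟩ : (regionOf t G σ P).Nonempty := regionOf_nonempty
  have := nonneg_of_forall_nat_add_pos (a := x i - x j) (b := v i - v j) fun m => by
    have := (nsmul_add_mem hv hx m).1 i j hij
    simp only [Pi.add_apply, nsmul_eq_mul, Pi.mul_apply, Pi.natCast_apply] at this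
    linarith
  linarith

/-- The upper bound attached to the arc survives adding all multiples of `v`. Together with
`recessionCone_antitone` it forces `v` to be constant from `src t a` to `b`. -/
theorem recessionCone_arc (h : Compatible t σ P) (hG : IsGPartition G P) {v : Fin n → ℝ}
    (hv : v ∈ recessionCone (regionOf t G σ P)) {a b : Fin n} (hab : IsArc P a b) :
    v (src t a) ≤ v b := by
  obtain ⟨x, hx⟩ : (regionOf t G σ P).Nonempty := regionOf_nonempty
  have := nonneg_of_forall_nat_add_pos (a := lev t a - (x (src t a) - x b))
    (b := v b - v (src t a)) fun m => by
      have := ((nsmul_add_mem hv hx m).2 a b hab.lt (hG _ _ hab) (h.1 _ _ hab)).1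
        ⟨a, b, hab, le_rfl, le_rfl⟩
      simp only [Pi.add_apply, nsmul_eq_mul, Pi.mul_apply, Pi.natCast_apply] at this
      linarith
  linarith

/-- The indicator function of the positions from `j` on. -/
noncomputable def tailVec (σ : Equiv.Perm (Fin n)) (j : Fin n) : Fin n → ℝ :=
  fun i => if σ j ≤ σ i then 1 else 0

/-- Lowering all coordinates from the position of `j` on preserves the order and the lower bounds.
It could only break an upper bound for a pair straddling that gap, but then the arc generating the
bound would cover `j`. -/
theorem neg_tailVec_mem_recessionCone {j : Fin n} (hj : ¬ Covered t σ P j) :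
    - tailVec σ j ∈ recessionCone (regionOf t G σ P) := by
  intro x hx
  have hanti : ∀ a b, σ a < σ b → tailVec σ j a ≤ tailVec σ j b := by
    intro a b hab
    unfold tailVec
    split_ifs with h1 h2
    · exact le_rfl
    · exact absurd (h1.trans hab.le) h2
    · exact zero_le_one
    · exact le_rfl
  refine ⟨fun a b hab => ?_, fun a b hab hG hlt => ⟨fun hb => ?_, fun hb => ?_⟩⟩
  · have h1 := hx.1 a b hab
    have h2 := hanti a b hab
    simp only [Pi.add_apply, Pi.neg_apply]
    linarith
  · have h1 := (hx.2 a b hab hG hlt).1 hb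
    obtain ⟨c, d, hcd, hk, hd⟩ := hb
    have h2 : tailVec σ j b ≤ tailVec σ j (src t a) := by
      unfold tailVec
      split_ifs with h3 h4
      · exact le_rfl
      · exact absurd ⟨c, d, hcd, (src_le_of_key_le t σ hk).trans_lt (not_le.1 h4), h3.trans hd⟩ hj
      · exact zero_le_one
      · exact le_rfl
    simp only [Pi.add_apply, Pi.neg_apply]
    linarith
  · have h1 := (hx.2 a b hab hG hlt).2 hb
    have h2 := hanti _ _ hlt
    simp only [Pi.add_apply, Pi.neg_apply]
    linarith

/-- The value of `v` at position `p - 1`, and zero for `p = 0`. -/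
noncomputable def posValue (σ : Equiv.Perm (Fin n)) (v : Fin n → ℝ) : ℕ → ℝ
  | 0 => 0
  | p + 1 => if h : p < n then v (σ.symm ⟨p, h⟩) else 0

theorem posValue_succ (v : Fin n → ℝ) (j : Fin n) : posValue σ v ((σ j : ℕ) + 1) = v j := by
  simp [posValue]

/-- Summation by parts: the coefficients are the successive jumps of `v` along the positions and
telescope. -/
theorem sum_smul_tailVec (v : Fin n → ℝ) :
    ∑ j, (posValue σ v ((σ j : ℕ) + 1) - posValue σ v (σ j : ℕ)) • tailVec σ j = v := by
  ext i
  simp only [Finset.sum_apply, Pi.smul_apply, tailVec, smul_eq_mul]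
  rw [Equiv.sum_comp σ fun p : Fin n =>
    (posValue σ v ((p : ℕ) + 1) - posValue σ v (p : ℕ)) * if p ≤ σ i then (1 : ℝ) else 0]
  simp only [Fin.le_def]
  rw [Fin.sum_univ_eq_sum_range (fun p : ℕ => (posValue σ v (p + 1) - posValue σ v p) *
    if p ≤ (σ i : ℕ) then (1 : ℝ) else 0) n]
  simp only [mul_ite, mul_one, mul_zero]
  rw [← Finset.sum_filter]
  have hf : (Finset.range n).filter (fun p => p ≤ (σ i : ℕ)) = Finset.range ((σ i : ℕ) + 1) := by
    ext p
    have := (σ i).2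
    simp only [Finset.mem_filter, Finset.mem_range]
    omega
  rw [hf, Finset.sum_range_sub, posValue_succ]
  simp [posValue]

theorem linearIndependent_tailVec (σ : Equiv.Perm (Fin n)) : LinearIndependent ℝ (tailVec σ) := by
  refine linearIndependent_of_top_le_span_of_card_eq_finrank (fun v _ => ?_) (by simp)
  rw [← sum_smul_tailVec (σ := σ) v]
  exact Submodule.sum_mem _ fun j _ =>
    Submodule.smul_mem _ _ (Submodule.subset_span (Set.mem_range_self j))

theorem posValue_eq_of_covered (h : Compatible t σ P) (hG : IsGPartition G P) {v : Fin n → ℝ}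
    (hv : v ∈ recessionCone (regionOf t G σ P)) {j : Fin n} (hj : Covered t σ P j) :
    posValue σ v ((σ j : ℕ) + 1) = posValue σ v (σ j : ℕ) := by
  obtain ⟨a, b, hab, h1, h2⟩ := hj
  obtain ⟨p, hp⟩ : ∃ p, (σ j : ℕ) = p + 1 :=
    Nat.exists_eq_succ_of_ne_zero (Nat.ne_of_gt ((Nat.zero_le _).trans_lt h1))
  have hpn : p < n := by have := (σ j).2; omega
  have hanti : ∀ i j, σ i < σ j → v j ≤ v i := fun i j => recessionCone_antitone hv
  obtain ⟨j', hj'⟩ : ∃ j', σ j' = ⟨p, hpn⟩ := σ.surjective _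
  have hj'p : (σ j' : ℕ) = p := by rw [hj']
  rw [posValue_succ, hp, ← hj'p, posValue_succ]
  -- The four inequalities close up into a cycle, so `v` does not jump at the position of `j`.
  have e1 : v b ≤ v j := le_of_forall_lt hanti h2
  have e2 : v j ≤ v j' := le_of_forall_lt hanti (Fin.le_def.2 (by omega))
  have e3 : v j' ≤ v (src t a) := le_of_forall_lt hanti (Fin.le_def.2 (by
    have : (σ (src t a) : ℕ) < σ j := h1
    omega))
  have e4 := recessionCone_arc h hG hv hab
  linarith

open scoped Classical in
-- In the basis `tailVec` a recession vector has no component at a covered position, while each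
-- uncovered one contributes a negated basis vector to the cone.
theorem degreesOfFreedom_regionOf (h : Compatible t σ P) (hG : IsGPartition G P) :
    degreesOfFreedom (regionOf t G σ P) = (Finset.univ.filter fun j => ¬ Covered t σ P j).card := by
  have hspan : Submodule.span ℝ (recessionCone (regionOf t G σ P)) =
      Submodule.span ℝ (Set.range (tailVec σ ∘ (Subtype.val : {j // ¬ Covered t σ P j} → Fin n))) := by
    apply le_antisymm
    · refine Submodule.span_le.2 fun v hv => ?_
      rw [← sum_smul_tailVec (σ := σ) v]
      refine Submodule.sum_mem _ fun j _ => ?_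
      by_cases hj : Covered t σ P j
      · rw [posValue_eq_of_covered h hG hv hj, sub_self, zero_smul]
        exact Submodule.zero_mem _
      · exact Submodule.smul_mem _ _ (Submodule.subset_span ⟨⟨j, hj⟩, rfl⟩)
    · refine Submodule.span_le.2 ?_
      rintro _ ⟨⟨j, hj⟩, rfl⟩
      rw [Function.comp_apply, ← neg_neg (tailVec σ j)]
      exact Submodule.neg_mem _ (Submodule.subset_span (neg_tailVec_mem_recessionCone hj))
  rw [degreesOfFreedom, hspan, finrank_span_eq_card
    ((linearIndependent_tailVec σ).comp _ Subtype.val_injective), Fintype.card_subtype]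

open scoped Classical in
-- A right end is covered by its own arc, so uncovered elements are starts.
theorem card_uncovered_le (h : Compatible t σ P) :
    (Finset.univ.filter fun j => ¬ Covered t σ P j).card ≤ P.parts.card := by
  rw [← card_starts P]
  refine Finset.card_le_card fun j hj => ?_
  simp only [Finset.mem_filter, Finset.mem_univ, true_and] at hj ⊢
  exact fun i hi => hj ⟨i, j, hi, h.1 _ _ hi, le_rfl⟩

open scoped Classical in
theorem card_uncovered_pos (hn : 0 < n) :
    0 < (Finset.univ.filter fun j => ¬ Covered t σ P j).card := by
  refine Finset.card_pos.2 ⟨σ.symm ⟨0, hn⟩, ?_⟩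
  simp only [Finset.mem_filter, Finset.mem_univ, true_and]
  rintro ⟨a, b, -, h1, -⟩
  rw [Equiv.apply_symm_apply] at h1
  exact absurd h1 (Nat.not_lt_zero _)

end Freedom

/-! ### Building compatible permutations one position at a time -/

section Prefix

open scoped Classical

variable {n : ℕ} {t : Kind} {P : SetPartition n} {σ τ : Equiv.Perm (Fin n)}

/-- The compatibility conditions that concern the first `k` positions. -/
def CompatibleUpTo (t : Kind) (P : SetPartition n) (k : ℕ) (σ : Equiv.Perm (Fin n)) : Prop :=
  (∀ i j, IsArc P i j → (σ j : ℕ) < k → σ (src t i) < σ j) ∧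
    ∀ i j i' j', IsArc P i j → IsArc P i' j' → key t σ i < key t σ i' → (σ j' : ℕ) < k → σ j < σ j'

theorem compatibleUpTo_n : CompatibleUpTo t P n σ ↔ Compatible t σ P :=
  ⟨fun h => ⟨fun i j ha => h.1 i j ha (σ j).2,
      fun i j i' j' ha ha' hk => h.2 i j i' j' ha ha' hk (σ j').2⟩,
    fun h => ⟨fun i j ha _ => h.1 i j ha, fun i j i' j' ha ha' hk _ => h.2 i j i' j' ha ha' hk⟩⟩

/-- `σ` and `τ` have the same elements in the first `k` positions. -/
def AgreeUpTo (k : ℕ) (τ σ : Equiv.Perm (Fin n)) : Prop := ∀ y, (τ y : ℕ) < k → σ y = τ y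

theorem AgreeUpTo.eq_of_lt {k : ℕ} (h : AgreeUpTo k τ σ) {y : Fin n} (hy : (σ y : ℕ) < k) :
    σ y = τ y := by
  obtain ⟨z, hz⟩ := τ.surjective (σ y)
  have h1 := h z (by rw [hz]; exact hy)
  rw [hz] at h1
  rw [← hz, σ.injective h1]

theorem AgreeUpTo.lt_iff {k : ℕ} (h : AgreeUpTo k τ σ) {y : Fin n} :
    (σ y : ℕ) < k ↔ (τ y : ℕ) < k :=
  ⟨fun hy => h.eq_of_lt hy ▸ hy, fun hy => (h y hy).symm ▸ hy⟩

/-- In the Shi case the keys depend on the permutation, but everything before an element of the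
common prefix is in the prefix too. -/
theorem AgreeUpTo.key_lt_iff {k : ℕ} (h : AgreeUpTo k τ σ) {i i' : Fin n}
    (hi : (τ (src t i') : ℕ) < k) : key t σ i < key t σ i' ↔ key t τ i < key t τ i' := by
  cases t
  · have h1 : (τ i' : ℕ) < k := hi
    simp only [key]
    rw [h i' h1]
    constructor
    · intro h2
      rwa [← h.eq_of_lt (lt_trans h2 h1)]
    · intro h2
      rwa [h i (lt_trans h2 h1)]
  · exact Iff.rfl

/-- `j` is not the right end of an arc. -/
def IsStart (P : SetPartition n) (j : Fin n) : Prop := ∀ i, ¬ IsArc P i j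

/-- For Shi the chains run through the blocks of `P`; for Ish every right end steps directly to the
first element. -/
theorem exists_root_src (t : Kind) (P : SetPartition n) :
    ∃ r : Fin n → Fin n, (∀ i j, IsArc P i j → r j = r (src t i)) ∧ ∀ j, IsStart P j → r j = j := by
  obtain ⟨r, h1, h2⟩ := exists_root (fun u j => ∃ i, IsArc P i j ∧ u = src t i)
    (fun _ _ ⟨i, h, hu⟩ => hu ▸ (src_le t i).trans_lt h.lt)
    (fun _ _ _ ⟨_, h, hu⟩ ⟨_, h', hu'⟩ => by rw [hu, hu', h.left_unique h'])
  exact ⟨r, fun i j h => h1 _ _ ⟨i, h, rfl⟩, fun j h => h2 j fun _ ⟨i, hi, _⟩ => h i hi⟩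

/-- The first element of the chain through `j` obtained by stepping from the right end `j` of an arc
`i j` to `src t i`. -/
noncomputable def root (t : Kind) (P : SetPartition n) : Fin n → Fin n := (exists_root_src t P).choose

theorem root_arc {i j : Fin n} (h : IsArc P i j) : root t P j = root t P (src t i) :=
  (exists_root_src t P).choose_spec.1 i j h

theorem root_start {j : Fin n} (h : IsStart P j) : root t P j = j :=
  (exists_root_src t P).choose_spec.2 j h

theorem isStart_root (j : Fin n) : IsStart P (root t P j) := by
  induction j using WellFoundedLT.induction with
  | ind j ih =>
    by_cases h : IsStart P j
    · rwa [root_start h]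
    · obtain ⟨i, hi⟩ := not_forall_not.1 h
      rw [root_arc hi]
      exact ih _ ((src_le t i).trans_lt hi.lt)

/-- The elements at the first `k` positions. -/
noncomputable def placed (k : ℕ) (τ : Equiv.Perm (Fin n)) : Finset (Fin n) :=
  Finset.univ.filter fun y => (τ y : ℕ) < k

/-- The elements outside `A` whose root belongs to `A`. -/
noncomputable def pending (t : Kind) (P : SetPartition n) (A : Finset (Fin n)) : Finset (Fin n) :=
  Finset.univ.filter fun y => y ∉ A ∧ root t P y ∈ A

/-- The elements outside `A` that are not right ends of arcs. -/
noncomputable def freshStarts (P : SetPartition n) (A : Finset (Fin n)) : Finset (Fin n) :=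
  Finset.univ.filter fun y => y ∉ A ∧ IsStart P y

/-- The elements outside `A` that are right ends of arcs. -/
noncomputable def freshClosers (P : SetPartition n) (A : Finset (Fin n)) : Finset (Fin n) :=
  Finset.univ.filter fun y => y ∉ A ∧ ¬ IsStart P y

/-- The number of elements other than `x` with root `x`. -/
noncomputable def tailCard (t : Kind) (P : SetPartition n) (x : Fin n) : ℕ :=
  (Finset.univ.filter fun y => root t P y = x ∧ ¬ IsStart P y).card

/-- `x` is the right end of an arc that may be placed at position `k`. -/
def IsFront (t : Kind) (P : SetPartition n) (k : ℕ) (τ : Equiv.Perm (Fin n)) (x : Fin n) : Prop :=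
  k ≤ (τ x : ℕ) ∧ ∃ i, IsArc P i x ∧ (τ (src t i) : ℕ) < k ∧
    ∀ i' j', IsArc P i' j' → key t τ i' < key t τ i → (τ j' : ℕ) < k

noncomputable def fronts (t : Kind) (P : SetPartition n) (k : ℕ) (τ : Equiv.Perm (Fin n)) :
    Finset (Fin n) :=
  Finset.univ.filter fun x => IsFront t P k τ x

/-- The permutation `τ` with `x` moved to position `k`. -/
def place (k : Fin n) (τ : Equiv.Perm (Fin n)) (x : Fin n) : Equiv.Perm (Fin n) :=
  τ.trans (Equiv.swap k (τ x))

theorem place_self (k x : Fin n) : place k τ x x = k := by simp [place]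

theorem agreeUpTo_place {k x : Fin n} (hx : (k : ℕ) ≤ τ x) : AgreeUpTo k τ (place k τ x) := by
  intro y hy
  simp only [place, Equiv.trans_apply]
  refine Equiv.swap_apply_of_ne_of_ne (fun h => ?_) (fun h => ?_)
  · rw [h] at hy
    exact lt_irrefl _ hy
  · rw [h] at hy
    exact absurd hy (not_lt.2 hx)

theorem place_lt_succ_iff {k x : Fin n} (hx : (k : ℕ) ≤ τ x) {y : Fin n} :
    (place k τ x y : ℕ) < k + 1 ↔ (τ y : ℕ) < k ∨ y = x := by
  rw [Nat.lt_succ_iff_lt_or_eq, (agreeUpTo_place hx).lt_iff]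
  refine or_congr_right ⟨fun h => ?_, fun h => ?_⟩
  · exact (place k τ x).injective ((Fin.ext h).trans (place_self k x).symm)
  · rw [h, place_self]

theorem placed_place {k x : Fin n} (hx : (k : ℕ) ≤ τ x) :
    placed (k + 1) (place k τ x) = insert x (placed k τ) := by
  ext y
  simp only [placed, Finset.mem_filter, Finset.mem_univ, true_and, Finset.mem_insert,
    place_lt_succ_iff hx, or_comm]

theorem agreeUpTo_succ_place_iff {k x : Fin n} (hx : (k : ℕ) ≤ τ x) :
    AgreeUpTo (k + 1) (place k τ x) σ ↔ AgreeUpTo k τ σ ∧ σ x = k := by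
  constructor
  · intro h
    refine ⟨fun y hy => ?_, ?_⟩
    · rw [h y ((place_lt_succ_iff hx).2 (Or.inl hy)), agreeUpTo_place hx y hy]
    · rw [h x ((place_lt_succ_iff hx).2 (Or.inr rfl)), place_self]
  · rintro ⟨h1, h2⟩ y hy
    rcases (place_lt_succ_iff hx).1 hy with hy | rfl
    · rw [h1 y hy, agreeUpTo_place hx y hy]
    · rw [h2, place_self]

/-- The only new conditions concern the arc ending at `x`: a start has none, and a front satisfies
them by definition. -/
theorem CompatibleUpTo.place {k x : Fin n} (h : CompatibleUpTo t P k τ) (hx : (k : ℕ) ≤ τ x)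
    (hx' : IsStart P x ∨ IsFront t P k τ x) : CompatibleUpTo t P (k + 1) (place k τ x) := by
  have ha := agreeUpTo_place hx
  constructor
  · intro i j hij hj
    rcases (place_lt_succ_iff hx).1 hj with hj | rfl
    · have h1 := h.1 i j hij hj
      rwa [ha j hj, ha _ (lt_trans h1 hj)]
    · rcases hx' with hx' | ⟨-, i', hi', h1, -⟩
      · exact absurd hij (hx' i)
      · obtain rfl := hij.left_unique hi'
        rw [place_self, ha _ h1]
        exact h1
  · intro i j i' j' hij hij' hk hj
    rcases (place_lt_succ_iff hx).1 hj with hj | rfl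
    · have h1 := h.1 i' j' hij' hj
      rw [ha.key_lt_iff (lt_trans h1 hj)] at hk
      have h2 := h.2 i j i' j' hij hij' hk hj
      rwa [ha j' hj, ha _ (lt_trans h2 hj)]
    · rcases hx' with hx' | ⟨-, i'', hi', h1, h2⟩
      · exact absurd hij' (hx' i')
      · obtain rfl := hij'.left_unique hi'
        rw [ha.key_lt_iff h1] at hk
        have h3 := h2 i j hij hk
        rw [place_self, ha _ h3]
        exact h3

theorem Compatible.isStart_or_isFront {k : ℕ} {x : Fin n} (h : Compatible t σ P)
    (ha : AgreeUpTo k τ σ) (hx : (σ x : ℕ) = k) : IsStart P x ∨ IsFront t P k τ x := by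
  by_cases hs : IsStart P x
  · exact Or.inl hs
  · obtain ⟨i, hi⟩ := not_forall_not.1 hs
    have h1 : (σ (src t i) : ℕ) < k := hx ▸ h.1 i x hi
    rw [ha.lt_iff] at h1
    refine Or.inr ⟨not_lt.1 fun hlt => (ha.lt_iff.2 hlt).ne hx, i, hi, h1, fun i' j' hij' hk => ?_⟩
    rw [← ha.key_lt_iff h1] at hk
    rw [← ha.lt_iff, ← hx]
    exact h.2 _ _ _ _ hij' hi hk

/-- The compatible permutations with property `D` having the same first `k` elements as `τ`. -/
noncomputable def extensions (t : Kind) (P : SetPartition n) (k : ℕ) (τ : Equiv.Perm (Fin n))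
    (D : Equiv.Perm (Fin n) → Prop) : Finset (Equiv.Perm (Fin n)) :=
  Finset.univ.filter fun σ => Compatible t σ P ∧ AgreeUpTo k τ σ ∧ D σ

theorem mem_extensions {k : ℕ} {D : Equiv.Perm (Fin n) → Prop} :
    σ ∈ extensions t P k τ D ↔ Compatible t σ P ∧ AgreeUpTo k τ σ ∧ D σ := by
  simp [extensions]

/-- The compatible permutations extending a given prefix, sorted by their next element. -/
theorem card_extensions {k : Fin n} (D : Equiv.Perm (Fin n) → Prop) :
    (extensions t P k τ D).card =
      ∑ x ∈ freshStarts P (placed k τ), (extensions t P (k + 1) (place k τ x) D).card +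
      ∑ x ∈ fronts t P k τ, (extensions t P (k + 1) (place k τ x) D).card := by
  have hdisj : Disjoint (freshStarts P (placed k τ)) (fronts t P k τ) := by
    rw [Finset.disjoint_left]
    intro x hx hx'
    obtain ⟨-, i, hi, -⟩ := (Finset.mem_filter.1 hx').2
    exact (Finset.mem_filter.1 hx).2.2 i hi
  have hle : ∀ x ∈ freshStarts P (placed k τ) ∪ fronts t P k τ, (k : ℕ) ≤ τ x := by
    intro x hx
    rcases Finset.mem_union.1 hx with hx | hx
    · have := (Finset.mem_filter.1 hx).2.1
      simpa [placed] using this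
    · exact (Finset.mem_filter.1 hx).2.1
  rw [← Finset.sum_union hdisj, Finset.card_eq_sum_card_fiberwise (f := fun σ => σ.symm k)
    (t := freshStarts P (placed k τ) ∪ fronts t P k τ)]
  · refine Finset.sum_congr rfl fun x hx => ?_
    congr 1
    ext σ
    simp only [Finset.mem_filter, mem_extensions, agreeUpTo_succ_place_iff (hle x hx),
      Equiv.symm_apply_eq]
    constructor
    · rintro ⟨⟨h1, h2, h3⟩, h4⟩
      exact ⟨h1, ⟨h2, h4.symm⟩, h3⟩
    · rintro ⟨h1, ⟨h2, h4⟩, h3⟩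
      exact ⟨⟨h1, h2, h3⟩, h4.symm⟩
  · intro σ hσ
    obtain ⟨h1, h2, -⟩ := mem_extensions.1 hσ
    have hk : (σ (σ.symm k) : ℕ) = k := by simp
    have hnp : σ.symm k ∉ placed k τ := fun hm => by
      have := h2.lt_iff.2 (Finset.mem_filter.1 hm).2
      omega
    rw [Finset.mem_coe, Finset.mem_union]
    rcases h1.isStart_or_isFront h2 hk with h | h
    · exact Or.inl (Finset.mem_filter.2 ⟨Finset.mem_univ _, hnp, h⟩)
    · exact Or.inr (Finset.mem_filter.2 ⟨Finset.mem_univ _, h⟩)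

/-! ### Pending elements, fronts and their change under placing an element -/

section Counts

variable {k : ℕ}

theorem mem_placed {y : Fin n} : y ∈ placed k τ ↔ (τ y : ℕ) < k := by simp [placed]

theorem CompatibleUpTo.root_mem (h : CompatibleUpTo t P k τ) (y : Fin n) (hy : y ∈ placed k τ) :
    root t P y ∈ placed k τ := by
  induction y using WellFoundedLT.induction with
  | ind y ih =>
    by_cases hs : IsStart P y
    · rwa [root_start hs]
    · obtain ⟨i, hi⟩ := not_forall_not.1 hs
      rw [root_arc hi]
      rw [mem_placed] at hy
      exact ih _ ((src_le t i).trans_lt hi.lt) (mem_placed.2 (lt_trans (h.1 i y hi hy) hy))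

/-- The chain from `y` back to its root starts outside `A` and ends in `A`, so one of its steps
enters `A`. -/
theorem exists_arc_of_mem_pending {A : Finset (Fin n)} (y : Fin n) (hy : y ∈ pending t P A) :
    ∃ a b, IsArc P a b ∧ src t a ∈ A ∧ b ∉ A := by
  induction y using WellFoundedLT.induction with
  | ind y ih =>
    obtain ⟨-, h1, h2⟩ := Finset.mem_filter.1 hy
    by_cases hs : IsStart P y
    · exact absurd (root_start hs ▸ h2) h1
    · obtain ⟨i, hi⟩ := not_forall_not.1 hs
      by_cases hA : src t i ∈ A
      · exact ⟨i, y, hi, hA, h1⟩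
      · rw [root_arc hi] at h2
        exact ih _ ((src_le t i).trans_lt hi.lt)
          (Finset.mem_filter.2 ⟨Finset.mem_univ _, hA, h2⟩)

theorem pending_nonempty_iff (h : CompatibleUpTo t P k τ) :
    (pending t P (placed k τ)).Nonempty ↔
      ∃ a b, IsArc P a b ∧ (τ (src t a) : ℕ) < k ∧ k ≤ (τ b : ℕ) := by
  constructor
  · rintro ⟨y, hy⟩
    obtain ⟨a, b, hab, h1, h2⟩ := exists_arc_of_mem_pending y hy
    rw [mem_placed] at h1 h2
    exact ⟨a, b, hab, h1, not_lt.1 h2⟩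
  · rintro ⟨a, b, hab, h1, h2⟩
    refine ⟨b, Finset.mem_filter.2 ⟨Finset.mem_univ _, ?_, ?_⟩⟩
    · rw [mem_placed]
      exact not_lt.2 h2
    · rw [root_arc hab]
      exact h.root_mem _ (mem_placed.2 h1)

theorem IsFront.unique {x x' : Fin n} (h : IsFront t P k τ x) (h' : IsFront t P k τ x') : x = x' := by
  obtain ⟨h1, i, hi, -, h2⟩ := h
  obtain ⟨h1', i', hi', -, h2'⟩ := h'
  rcases lt_trichotomy (key t τ i) (key t τ i') with hk | hk | hk
  · exact absurd (h2' _ _ hi hk) (not_lt.2 h1)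
  · obtain rfl := key_injective t τ hk
    exact hi.right_unique hi'
  · exact absurd (h2 _ _ hi' hk) (not_lt.2 h1')

/-- Take the open arc of smallest key. An arc with a smaller key has its source placed as well, so
by minimality its right end is already placed. -/
theorem exists_isFront (h : ∃ a b, IsArc P a b ∧ (τ (src t a) : ℕ) < k ∧ k ≤ (τ b : ℕ)) :
    ∃ x, IsFront t P k τ x := by
  obtain ⟨a, b, hab⟩ := h
  obtain ⟨⟨i, x⟩, hix, hmin⟩ := ((Finset.univ : Finset (Fin n × Fin n)).filter fun p =>
    IsArc P p.1 p.2 ∧ (τ (src t p.1) : ℕ) < k ∧ k ≤ (τ p.2 : ℕ)).exists_min_image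
    (fun p => key t τ p.1) ⟨(a, b), by simpa using hab⟩
  simp only [Finset.mem_filter, Finset.mem_univ, true_and, Prod.forall] at hix hmin
  refine ⟨x, hix.2.2, i, hix.1, hix.2.1, fun i' j' hij' hk => ?_⟩
  by_contra hcon
  have h1 : τ (src t i') ≤ τ (src t i) := src_le_of_key_le t τ hk.le
  exact absurd hk (not_lt.2 (hmin i' j' ⟨hij', lt_of_le_of_lt h1 hix.2.1, not_lt.1 hcon⟩))

theorem card_fronts (h : CompatibleUpTo t P k τ) :
    (pending t P (placed k τ)).card = 0 ∧ fronts t P k τ = ∅ ∨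
      0 < (pending t P (placed k τ)).card ∧ ∃ x, IsFront t P k τ x ∧ fronts t P k τ = {x} := by
  rcases (pending t P (placed k τ)).eq_empty_or_nonempty with he | hne
  · refine Or.inl ⟨Finset.card_eq_zero.2 he, Finset.filter_eq_empty_iff.2 fun x _ hx => ?_⟩
    obtain ⟨h1, i, hi, h2, -⟩ := hx
    have := (pending_nonempty_iff h).2 ⟨i, x, hi, h2, h1⟩
    rw [he] at this
    exact Finset.not_nonempty_empty this
  · obtain ⟨x, hx⟩ := exists_isFront ((pending_nonempty_iff h).1 hne)
    refine Or.inr ⟨Finset.card_pos.2 hne, x, hx, ?_⟩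
    ext y
    simp only [fronts, Finset.mem_filter, Finset.mem_univ, true_and, Finset.mem_singleton]
    exact ⟨fun hy => hy.unique hx, fun hy => hy ▸ hx⟩

theorem card_pending_insert_start (h : CompatibleUpTo t P k τ) {x : Fin n}
    (hx : x ∈ freshStarts P (placed k τ)) :
    (pending t P (insert x (placed k τ))).card =
      (pending t P (placed k τ)).card + tailCard t P x := by
  obtain ⟨-, hxA, hxs⟩ := Finset.mem_filter.1 hx
  rw [tailCard, ← Finset.card_union_of_disjoint]
  · congr 1
    ext y
    simp only [pending, Finset.mem_union, Finset.mem_filter, Finset.mem_univ, true_and,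
      Finset.mem_insert, not_or]
    constructor
    · rintro ⟨⟨h1, h2⟩, h3 | h3⟩
      · exact Or.inr ⟨h3, fun hs => h1 ((root_start hs).symm.trans h3)⟩
      · exact Or.inl ⟨h2, h3⟩
    · rintro (⟨h1, h2⟩ | ⟨h1, h2⟩)
      · refine ⟨⟨?_, h1⟩, Or.inr h2⟩
        rintro rfl
        exact h1 (root_start hxs ▸ h2)
      · refine ⟨⟨?_, fun hy => hxA (h1 ▸ h.root_mem y hy)⟩, Or.inl h1⟩
        rintro rfl
        exact h2 hxs
  · rw [Finset.disjoint_left]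
    intro y hy hy'
    exact hxA ((Finset.mem_filter.1 hy').2.1 ▸ (Finset.mem_filter.1 hy).2.2)

theorem card_pending_insert_front {x : Fin n} (h : CompatibleUpTo t P k τ)
    (hx : IsFront t P k τ x) :
    (pending t P (insert x (placed k τ))).card + 1 = (pending t P (placed k τ)).card := by
  obtain ⟨h1, i, hi, h2, -⟩ := hx
  have hxp : x ∈ pending t P (placed k τ) := Finset.mem_filter.2 ⟨Finset.mem_univ _,
    fun hm => not_lt.2 h1 (mem_placed.1 hm), root_arc hi ▸ h.root_mem _ (mem_placed.2 h2)⟩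
  rw [← Finset.card_erase_add_one hxp]
  congr 2
  ext y
  simp only [pending, Finset.mem_erase, Finset.mem_filter, Finset.mem_univ, true_and,
    Finset.mem_insert, not_or]
  constructor
  · rintro ⟨⟨h3, h4⟩, h5 | h5⟩
    · exact absurd hi ((h5 ▸ isStart_root y : IsStart P x) i)
    · exact ⟨h3, h4, h5⟩
  · rintro ⟨h3, h4, h5⟩
    exact ⟨⟨h3, h4⟩, Or.inr h5⟩

theorem card_freshStarts_insert_start {A : Finset (Fin n)} {x : Fin n} (hx : x ∈ freshStarts P A) :
    (freshStarts P (insert x A)).card = (freshStarts P A).card - 1 := by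
  rw [← Finset.card_erase_of_mem hx]
  congr 1
  ext y
  simp only [freshStarts, Finset.mem_erase, Finset.mem_filter, Finset.mem_univ, true_and,
    Finset.mem_insert, not_or]
  tauto

theorem freshStarts_insert_front {A : Finset (Fin n)} {x : Fin n} (hx : ¬ IsStart P x) :
    freshStarts P (insert x A) = freshStarts P A := by
  ext y
  simp only [freshStarts, Finset.mem_filter, Finset.mem_univ, true_and, Finset.mem_insert, not_or]
  constructor
  · tauto
  · rintro ⟨h1, h2⟩
    exact ⟨⟨fun h => hx (h ▸ h2), h1⟩, h2⟩

theorem freshClosers_insert_start {A : Finset (Fin n)} {x : Fin n} (hx : IsStart P x) :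
    freshClosers P (insert x A) = freshClosers P A := by
  ext y
  simp only [freshClosers, Finset.mem_filter, Finset.mem_univ, true_and, Finset.mem_insert, not_or]
  constructor
  · tauto
  · rintro ⟨h1, h2⟩
    exact ⟨⟨fun h => h2 (h ▸ hx), h1⟩, h2⟩

theorem card_freshClosers_insert_front {A : Finset (Fin n)} {x : Fin n} (hxA : x ∉ A)
    (hx : ¬ IsStart P x) :
    (freshClosers P (insert x A)).card + 1 = (freshClosers P A).card := by
  have hm : x ∈ freshClosers P A := Finset.mem_filter.2 ⟨Finset.mem_univ _, hxA, hx⟩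
  rw [← Finset.card_erase_add_one hm]
  congr 2
  ext y
  simp only [freshClosers, Finset.mem_erase, Finset.mem_filter, Finset.mem_univ, true_and,
    Finset.mem_insert, not_or]
  tauto

/-- Unused right ends are either pending or belong to the chain of an unused start. This total is
all the recursion needs to know about the chain lengths. -/
theorem sum_tailCard (h : CompatibleUpTo t P k τ) :
    ∑ x ∈ freshStarts P (placed k τ), tailCard t P x + (pending t P (placed k τ)).card =
      (freshClosers P (placed k τ)).card := by
  rw [← Finset.card_filter_add_card_filter_not (s := freshClosers P (placed k τ))
    (fun y => root t P y ∉ placed k τ)]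
  congr 1
  · rw [Finset.card_eq_sum_card_fiberwise (f := root t P) (t := freshStarts P (placed k τ))]
    · refine Finset.sum_congr rfl fun x hx => ?_
      obtain ⟨-, hxA, hxs⟩ := Finset.mem_filter.1 hx
      rw [tailCard]
      congr 1
      ext y
      simp only [freshClosers, Finset.mem_filter, Finset.mem_univ, true_and]
      constructor
      · rintro ⟨h1, h2⟩
        exact ⟨⟨⟨fun hy => hxA (h1 ▸ h.root_mem y hy), h2⟩, h1 ▸ hxA⟩, h1⟩
      · rintro ⟨⟨⟨-, h2⟩, -⟩, h1⟩
        exact ⟨h1, h2⟩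
    · intro y hy
      exact Finset.mem_coe.2 (Finset.mem_filter.2
        ⟨Finset.mem_univ _, (Finset.mem_filter.1 hy).2, isStart_root y⟩)
  · congr 1
    ext y
    simp only [pending, freshClosers, Finset.mem_filter, Finset.mem_univ, true_and, not_not]
    constructor
    · rintro ⟨h1, h2⟩
      exact ⟨⟨h1, fun hs => h1 (root_start hs ▸ h2)⟩, h2⟩
    · rintro ⟨⟨h1, -⟩, h2⟩
      exact ⟨h1, h2⟩

theorem card_freshStarts_add_card_freshClosers :
    (freshStarts P (placed k τ)).card + (freshClosers P (placed k τ)).card =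
      (Finset.univ \ placed k τ).card := by
  rw [← Finset.card_filter_add_card_filter_not (s := Finset.univ \ placed k τ) (IsStart P)]
  congr 2 <;> ext y <;> simp [freshStarts, freshClosers]

end Counts

end Prefix

/-! ### Counting compatible permutations -/

section Numbers

/-- The number of ways to complete a prefix with `r` pending elements, `u` fresh starts and `c` fresh
right ends of arcs. -/
noncomputable def completionCount (r u c : ℕ) : ℚ := (r + 1) * (u + c)! / (c + 1)!

/-- The number of ways to complete such a prefix with `d` further uncovered elements. -/
noncomputable def completionCountBy (r u c d : ℕ) : ℚ :=
  if c = 0 then (if d = u then (u ! : ℚ) else 0)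
  else if d ≤ u then ((c + (u - d) - 1)! : ℚ) / (c ! * (u - d)!) *
    (u ! * r + d * (u - 1)! * ((c : ℚ) - r))
  else 0

variable {α : Type*} (s : Finset α) (μ : α → ℕ)

theorem completionCount_zero_pending {c : ℕ} (h : ∑ x ∈ s, μ x = c) (hpos : 0 < s.card + c) :
    completionCount 0 s.card c = ∑ x ∈ s, completionCount (μ x) (s.card - 1) c := by
  have hu : 0 < s.card := by
    by_contra h0
    have : s = ∅ := Finset.card_eq_zero.1 (by omega)
    subst this
    simp only [Finset.sum_empty] at h
    simp [← h] at hpos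
  obtain ⟨u, hu⟩ := Nat.exists_eq_succ_of_ne_zero hu.ne'
  simp only [completionCount]
  rw [← Finset.sum_div, ← Finset.sum_mul, Finset.sum_add_distrib, ← Nat.cast_sum, h, hu]
  simp only [Finset.sum_const, nsmul_eq_mul, hu]
  rw [show u.succ + c = (u + c) + 1 by omega, Nat.factorial_succ, Nat.succ_sub_one]
  push_cast
  ring

/-- The formula is affine in the number of pending elements, so the sum over starts depends on `μ`
only through its total. The last term places the front. -/
theorem completionCount_succ_pending {r c : ℕ} (h : ∑ x ∈ s, μ x + r = c) :
    completionCount (r + 1) s.card (c + 1) =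
      ∑ x ∈ s, completionCount (r + 1 + μ x) (s.card - 1) (c + 1) + completionCount r s.card c := by
  have hq : (∑ x ∈ s, (μ x : ℚ)) = c - r := by
    rw [← Nat.cast_sum, ← h]
    push_cast
    ring
  rcases Nat.eq_zero_or_pos s.card with h0 | hu
  · have : s = ∅ := Finset.card_eq_zero.1 h0
    subst this
    simp only [Finset.sum_empty, zero_add] at h
    subst h
    simp only [completionCount, Finset.sum_empty, Finset.card_empty, zero_add]
    rw [Nat.factorial_succ (r + 1)]
    have := Nat.factorial_ne_zero r
    have := Nat.factorial_ne_zero (r + 1)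
    push_cast
    rw [Nat.factorial_succ r]
    push_cast
    field_simp
  · obtain ⟨u, hu⟩ := Nat.exists_eq_succ_of_ne_zero hu.ne'
    simp only [completionCount]
    rw [← Finset.sum_div, ← Finset.sum_mul]
    simp only [Nat.cast_add, Finset.sum_add_distrib, hq, hu, Finset.sum_const, nsmul_eq_mul]
    rw [show u.succ + (c + 1) = (u + c + 1) + 1 by omega, show u.succ - 1 + (c + 1) = u + c + 1 by
      omega, show u.succ + c = u + c + 1 by omega, Nat.factorial_succ (u + c + 1),
      Nat.factorial_succ (c + 1)]
    have := Nat.factorial_ne_zero (c + 1)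
    push_cast
    field_simp
    ring

theorem completionCountBy_zero_zero {u c : ℕ} (h : 0 < u + c) : completionCountBy 0 u c 0 = 0 := by
  rw [completionCountBy]
  split_ifs with h1 h2
  · omega
  · rfl
  · simp
  · rfl

/-- With nothing pending the next element must be a start and is uncovered, so `d` drops by one. -/
theorem completionCountBy_zero_succ {c d : ℕ} (h : ∑ x ∈ s, μ x = c) (hpos : 0 < s.card + c) :
    completionCountBy 0 s.card c (d + 1) =
      ∑ x ∈ s, completionCountBy (μ x) (s.card - 1) c d := by
  have hu : 0 < s.card := by
    by_contra h0
    have : s = ∅ := Finset.card_eq_zero.1 (by omega)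
    subst this
    simp only [Finset.sum_empty] at h
    simp [← h] at hpos
  obtain ⟨u, hu⟩ := Nat.exists_eq_succ_of_ne_zero hu.ne'
  have hq : (∑ x ∈ s, (μ x : ℚ)) = c := by rw [← Nat.cast_sum, h]
  rw [hu, Nat.succ_eq_add_one, Nat.add_sub_cancel]
  by_cases hc : c = 0
  · simp only [completionCountBy, if_pos hc, Finset.sum_const, hu, Nat.add_right_cancel_iff]
    split_ifs
    · rw [Nat.factorial_succ]
      simp
    · simp
  · simp only [completionCountBy, if_neg hc, Nat.add_le_add_iff_right]
    split_ifs with hd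
    · rw [← Finset.mul_sum, Finset.sum_add_distrib, ← Finset.mul_sum, ← Finset.mul_sum,
        Finset.sum_sub_distrib, hq, Finset.sum_const, hu, Nat.add_sub_add_right]
      congr 1
      rcases u with _ | u
      · obtain rfl : d = 0 := by omega
        simp
      · simp only [Nat.succ_eq_add_one, Nat.add_sub_cancel]
        rw [Nat.factorial_succ u]
        push_cast
        simp only [nsmul_eq_mul]
        push_cast
        ring
    · simp

theorem completionCountBy_succ_pending {r c d : ℕ} (h : ∑ x ∈ s, μ x + r = c) :
    completionCountBy (r + 1) s.card (c + 1) d =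
      ∑ x ∈ s, completionCountBy (r + 1 + μ x) (s.card - 1) (c + 1) d +
        completionCountBy r s.card c d := by
  have hq : (∑ x ∈ s, (μ x : ℚ)) = c - r := by
    rw [← Nat.cast_sum, ← h]
    push_cast
    ring
  have hc1 : c + 1 ≠ 0 := by omega
  have hfc := Nat.factorial_ne_zero c
  rcases lt_trichotomy d s.card with hd | hd | hd
  · obtain ⟨e, he⟩ : ∃ e, s.card = d + e + 1 := ⟨s.card - d - 1, by omega⟩
    have hfe := Nat.factorial_ne_zero e
    -- At `c = 0` the definition takes its special branch, but then `r = 0` and both sides vanish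
    -- because `d` differs from the number of starts.
    have hlast : completionCountBy r s.card c d =
        (c + e)! / (c ! * (e + 1)!) * (s.card ! * r + d * (s.card - 1)! * ((c : ℚ) - r)) := by
      rw [completionCountBy]
      split_ifs with h1 h2 h3
      · omega
      · have hr : r = 0 := by omega
        simp [h1, hr]
      · rw [show s.card - d = e + 1 by omega, show c + (e + 1) - 1 = c + e by omega]
      · omega
    rw [hlast]
    simp only [completionCountBy, if_neg hc1, if_pos hd.le, if_pos (by omega : d ≤ s.card - 1)]
    rw [← Finset.mul_sum, Finset.sum_add_distrib,
      ← Finset.mul_sum, ← Finset.mul_sum]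
    simp only [Nat.cast_add, Nat.cast_one, Finset.sum_sub_distrib, Finset.sum_add_distrib,
      Finset.sum_const, nsmul_eq_mul, hq]
    rw [he, show d + e + 1 - d = e + 1 by omega, show d + e + 1 - 1 = d + e by omega,
      show d + e - d = e by omega, show c + 1 + (e + 1) - 1 = c + e + 1 by omega,
      show c + 1 + e - 1 = c + e by omega, Nat.factorial_succ (c + e), Nat.factorial_succ c,
      Nat.factorial_succ e, Nat.factorial_succ (d + e)]
    -- The case `d = 0` is separate because `d + e - 1` is a truncated subtraction; there the factor
    -- `d` kills both sides.
    have key : (d : ℚ) * (d + e - 1 : ℕ)! * (d + e) = d * (d + e)! := by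
      rcases Nat.eq_zero_or_pos d with rfl | hd0
      · simp
      · obtain ⟨m, hm⟩ := Nat.exists_eq_succ_of_ne_zero hd0.ne'
        rw [show d + e - 1 = m + e by omega, show d + e = (m + e) + 1 by omega,
          Nat.factorial_succ, hm]
        push_cast
        ring
    push_cast
    field_simp
    linear_combination (-((e : ℚ) + 1)) * (c - r) * key
  -- When every start has to be uncovered the value is `s.card !`. Without starts the general
  -- formula gives `r' / c'`, hence the side condition.
  · have hF : ∀ r' c' : ℕ, (s.card = 0 → r' = c') → completionCountBy r' s.card c' d = s.card ! := by
      intro r' c' hr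
      rw [completionCountBy, hd]
      split_ifs with h1 h2 h3
      · rfl
      · exact absurd rfl h2
      · obtain ⟨m, rfl⟩ := Nat.exists_eq_succ_of_ne_zero h1
        have := Nat.factorial_ne_zero m
        rw [Nat.sub_self, show m.succ + 0 - 1 = m by omega]
        rcases Nat.eq_zero_or_pos s.card with h0 | hu
        · rw [hr h0, h0, Nat.factorial_succ]
          push_cast
          field_simp
          simp
        · obtain ⟨u, hu⟩ := Nat.exists_eq_succ_of_ne_zero hu.ne'
          rw [hu, Nat.succ_sub_one, Nat.succ_eq_add_one, Nat.factorial_succ u, Nat.factorial_succ m]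
          push_cast
          field_simp
          simp
      · exact absurd le_rfl h3
    have hr : s.card = 0 → r = c := by
      intro h0
      have : s = ∅ := Finset.card_eq_zero.1 h0
      subst this
      simpa using h
    rw [hF _ _ hr, hF _ _ (fun h0 => by rw [hr h0]), Finset.sum_eq_zero, zero_add]
    intro x hx
    have : 0 < s.card := Finset.card_pos.2 ⟨x, hx⟩
    rw [completionCountBy, if_neg hc1, if_neg (by omega)]
  · rw [Finset.sum_eq_zero]
    · simp only [completionCountBy, if_neg hc1, if_neg hd.ne', if_neg (not_le.2 hd), ite_self,
        add_zero]
    · intro x hx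
      rw [completionCountBy, if_neg hc1, if_neg (by omega)]

end Numbers

/-! ### Compatible completions of a prefix -/

section Counting

open scoped Classical

variable {n : ℕ} {t : Kind} {P : SetPartition n} {σ τ : Equiv.Perm (Fin n)}

/-- Whether the next position is covered is decided by the prefix: an arc is open there exactly when
something is pending. -/
theorem covered_iff_pending {k x : Fin n} (h : CompatibleUpTo t P k τ) (ha : AgreeUpTo k τ σ)
    (hx : σ x = k) : Covered t σ P x ↔ 0 < (pending t P (placed k τ)).card := by
  rw [Finset.card_pos, pending_nonempty_iff h]
  refine exists_congr fun a => exists_congr fun b => and_congr_right fun _ => ?_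
  rw [hx, ← ha.lt_iff, ← not_lt (b := (k : ℕ)), ← ha.lt_iff, not_lt]
  exact Iff.rfl

/-- The number of uncovered elements at positions from `k` on. -/
noncomputable def uncoveredFrom (t : Kind) (P : SetPartition n) (k : ℕ) (σ : Equiv.Perm (Fin n)) :
    ℕ :=
  (Finset.univ.filter fun j => k ≤ (σ j : ℕ) ∧ ¬ Covered t σ P j).card

theorem uncoveredFrom_zero :
    uncoveredFrom t P 0 σ = (Finset.univ.filter fun j => ¬ Covered t σ P j).card := by
  simp [uncoveredFrom]

theorem uncoveredFrom_eq {k x : Fin n} (hx : σ x = k) :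
    uncoveredFrom t P k σ =
      uncoveredFrom t P (k + 1) σ + if Covered t σ P x then 0 else 1 := by
  have hle : ∀ j, (k : ℕ) ≤ σ j ↔ (k : ℕ) + 1 ≤ σ j ∨ j = x := by
    intro j
    rw [Nat.succ_le_iff, le_iff_lt_or_eq]
    refine or_congr_right ⟨fun h => ?_, fun h => ?_⟩
    · exact σ.injective ((Fin.ext h.symm).trans hx.symm)
    · rw [h, hx]
  have hx' : ¬ (k : ℕ) + 1 ≤ σ x := by rw [hx]; omega
  unfold uncoveredFrom
  split_ifs with hc
  · rw [add_zero]
    congr 1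
    ext j
    simp only [Finset.mem_filter, Finset.mem_univ, true_and, hle]
    constructor
    · rintro ⟨h1 | rfl, h2⟩
      · exact ⟨h1, h2⟩
      · exact absurd hc h2
    · exact fun h => ⟨Or.inl h.1, h.2⟩
  · rw [← Finset.card_insert_of_notMem (a := x)
      (fun hm => hx' (Finset.mem_filter.1 hm).2.1)]
    congr 1
    ext j
    simp only [Finset.mem_filter, Finset.mem_univ, true_and, hle, Finset.mem_insert]
    constructor
    · rintro ⟨h1 | h1, h2⟩
      · exact Or.inr ⟨h1, h2⟩
      · exact Or.inl h1
    · rintro (rfl | h)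
      · exact ⟨Or.inr rfl, hc⟩
      · exact ⟨Or.inl h.1, h.2⟩

theorem placed_n : placed n τ = Finset.univ := by
  ext y
  simp [placed]

theorem le_of_mem_freshStarts {k : ℕ} {x : Fin n} (hx : x ∈ freshStarts P (placed k τ)) :
    k ≤ (τ x : ℕ) := by
  have := (Finset.mem_filter.1 hx).2.1
  rwa [mem_placed, not_lt] at this

theorem IsFront.not_isStart {k : ℕ} {x : Fin n} (h : IsFront t P k τ x) : ¬ IsStart P x := by
  obtain ⟨-, i, hi, -⟩ := h
  exact fun hs => hs i hi

theorem fresh_card_pos {k : Fin n} :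
    0 < (freshStarts P (placed k τ)).card + (freshClosers P (placed k τ)).card := by
  rw [card_freshStarts_add_card_freshClosers, Finset.card_pos]
  exact ⟨τ.symm k, by simp [mem_placed]⟩

theorem card_extensions_n (D : Equiv.Perm (Fin n) → Prop) (h : Compatible t τ P) :
    (extensions t P n τ D).card = if D τ then 1 else 0 := by
  have hag : ∀ σ : Equiv.Perm (Fin n), AgreeUpTo n τ σ ↔ σ = τ :=
    fun σ => ⟨fun ha => Equiv.ext fun y => ha y (τ y).2, fun ha y _ => by rw [ha]⟩
  split_ifs with hD
  · rw [Finset.card_eq_one]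
    refine ⟨τ, ?_⟩
    ext σ
    simp only [mem_extensions, hag, Finset.mem_singleton]
    exact ⟨fun h => h.2.1, fun he => by rw [he]; exact ⟨h, rfl, hD⟩⟩
  · rw [Finset.card_eq_zero, Finset.eq_empty_iff_forall_notMem]
    intro σ hσ
    obtain ⟨-, h2, h3⟩ := mem_extensions.1 hσ
    exact hD ((hag σ).1 h2 ▸ h3)

/-- Induction on the number `L` of unfilled positions, sorting the completions by their next
element. -/
theorem card_compatible_agree (L : ℕ) : ∀ (k : ℕ) (τ : Equiv.Perm (Fin n)), k + L = n →
    CompatibleUpTo t P k τ →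
    ((extensions t P k τ (fun _ => True)).card : ℚ) =
      completionCount (pending t P (placed k τ)).card (freshStarts P (placed k τ)).card
        (freshClosers P (placed k τ)).card := by
  induction L with
  | zero =>
    rintro k τ hk h
    obtain rfl : k = n := by omega
    rw [card_extensions_n _ (compatibleUpTo_n.1 h), placed_n]
    simp [pending, freshStarts, freshClosers, completionCount]
  | succ L ih =>
    rintro k' τ hk h
    obtain ⟨k, rfl⟩ : ∃ k : Fin n, (k : ℕ) = k' := ⟨⟨k', by omega⟩, rfl⟩
    have hstart : ∀ x ∈ freshStarts P (placed k τ),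
        ((extensions t P (k + 1) (place k τ x) (fun _ => True)).card : ℚ) =
        completionCount ((pending t P (placed k τ)).card + tailCard t P x)
          ((freshStarts P (placed k τ)).card - 1) (freshClosers P (placed k τ)).card := by
      intro x hx
      have hxk := le_of_mem_freshStarts hx
      have hxs := (Finset.mem_filter.1 hx).2.2
      rw [ih _ _ (by omega) (h.place hxk (Or.inl hxs)), placed_place hxk,
        card_pending_insert_start h hx, card_freshStarts_insert_start hx,
        freshClosers_insert_start hxs]
    have hsum := sum_tailCard h
    rw [card_extensions, Nat.cast_add, Nat.cast_sum, Nat.cast_sum, Finset.sum_congr rfl hstart]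
    rcases card_fronts h with ⟨h0, hf⟩ | ⟨hpos, x, hx, hf⟩
    · rw [h0, add_zero] at hsum
      rw [hf, h0, completionCount_zero_pending _ _ hsum fresh_card_pos]
      simp
    · have e1 := card_pending_insert_front h hx
      have e2 := card_freshClosers_insert_front (A := placed k τ)
        (fun hm => not_lt.2 hx.1 (mem_placed.1 hm)) hx.not_isStart
      rw [hf, Finset.sum_singleton, ih _ _ (by omega) (h.place hx.1 (Or.inr hx)),
        placed_place hx.1, freshStarts_insert_front hx.not_isStart, ← e1, ← e2,
        completionCount_succ_pending _ (tailCard t P)]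
      omega

theorem card_compatible_agree_uncovered (L : ℕ) : ∀ (k d : ℕ) (τ : Equiv.Perm (Fin n)), k + L = n →
    CompatibleUpTo t P k τ →
    ((extensions t P k τ (fun σ => uncoveredFrom t P k σ = d)).card : ℚ) =
      completionCountBy (pending t P (placed k τ)).card (freshStarts P (placed k τ)).card
        (freshClosers P (placed k τ)).card d := by
  induction L with
  | zero =>
    rintro k d τ hk h
    obtain rfl : k = n := by omega
    rw [card_extensions_n _ (compatibleUpTo_n.1 h), placed_n]
    have h0 : uncoveredFrom t P k τ = 0 := by
      rw [uncoveredFrom, Finset.card_eq_zero, Finset.filter_eq_empty_iff]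
      rintro j - ⟨hj, -⟩
      exact absurd (τ j).2 (not_lt.2 hj)
    simp [freshStarts, freshClosers, completionCountBy, h0, eq_comm]
  | succ L ih =>
    rintro k' d τ hk h
    obtain ⟨k, rfl⟩ : ∃ k : Fin n, (k : ℕ) = k' := ⟨⟨k', by omega⟩, rfl⟩
    have hstart : ∀ d, ∀ x ∈ freshStarts P (placed k τ),
        ((extensions t P (k + 1) (place k τ x) (fun σ => uncoveredFrom t P (k + 1) σ = d)).card : ℚ) =
        completionCountBy ((pending t P (placed k τ)).card + tailCard t P x)
          ((freshStarts P (placed k τ)).card - 1) (freshClosers P (placed k τ)).card d := by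
      intro d x hx
      have hxk := le_of_mem_freshStarts hx
      have hxs := (Finset.mem_filter.1 hx).2.2
      rw [ih _ _ _ (by omega) (h.place hxk (Or.inl hxs)), placed_place hxk,
        card_pending_insert_start h hx, card_freshStarts_insert_start hx,
        freshClosers_insert_start hxs]
    have hsum := sum_tailCard h
    rcases card_fronts h with ⟨h0, hf⟩ | ⟨hpos, x, hx, hf⟩
    -- Nothing is pending, so position `k` is uncovered in every completion and uses up one unit of
    -- `d`.
    · have hunc : ∀ σ, AgreeUpTo k τ σ →
          uncoveredFrom t P k σ = uncoveredFrom t P (k + 1) σ + 1 := by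
        intro σ ha
        have hk : σ (σ.symm k) = k := by simp
        rw [uncoveredFrom_eq hk, if_neg]
        rw [covered_iff_pending h ha hk, h0]
        exact lt_irrefl _
      rw [h0, add_zero] at hsum
      rw [h0] at hstart ⊢
      rcases d with _ | d
      · rw [completionCountBy_zero_zero fresh_card_pos, Nat.cast_eq_zero, Finset.card_eq_zero,
          Finset.eq_empty_iff_forall_notMem]
        intro σ hσ
        obtain ⟨-, ha, hu⟩ := mem_extensions.1 hσ
        rw [hunc σ ha] at hu
        exact absurd hu (Nat.succ_ne_zero _)
      · have hset : extensions t P k τ (fun σ => uncoveredFrom t P k σ = d + 1) =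
            extensions t P k τ (fun σ => uncoveredFrom t P (k + 1) σ = d) := by
          ext σ
          rw [mem_extensions, mem_extensions]
          refine and_congr_right fun _ => and_congr_right fun ha => ?_
          rw [hunc σ ha, Nat.add_right_cancel_iff]
        rw [hset, card_extensions, Nat.cast_add, Nat.cast_sum, Nat.cast_sum,
          Finset.sum_congr rfl (hstart d), hf, completionCountBy_zero_succ _ _ hsum fresh_card_pos]
        simp
    -- Something is pending, so position `k` is covered and `d` is unchanged.
    · have hset : extensions t P k τ (fun σ => uncoveredFrom t P k σ = d) =
            extensions t P k τ (fun σ => uncoveredFrom t P (k + 1) σ = d) := by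
        ext σ
        rw [mem_extensions, mem_extensions]
        refine and_congr_right fun _ => and_congr_right fun ha => ?_
        have hk : σ (σ.symm k) = k := by simp
        rw [uncoveredFrom_eq hk, if_pos ((covered_iff_pending h ha hk).2 hpos), add_zero]
      have e1 := card_pending_insert_front h hx
      have e2 := card_freshClosers_insert_front (A := placed k τ)
        (fun hm => not_lt.2 hx.1 (mem_placed.1 hm)) hx.not_isStart
      rw [hset, card_extensions, Nat.cast_add, Nat.cast_sum, Nat.cast_sum,
        Finset.sum_congr rfl (hstart d), hf, Finset.sum_singleton,
        ih _ _ _ (by omega) (h.place hx.1 (Or.inr hx)),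
        placed_place hx.1, freshStarts_insert_front hx.not_isStart, ← e1, ← e2,
        completionCountBy_succ_pending _ (tailCard t P)]
      omega

theorem compatibleUpTo_zero : CompatibleUpTo t P 0 τ :=
  ⟨fun _ _ _ h => absurd h (Nat.not_lt_zero _), fun _ _ _ _ _ _ _ h => absurd h (Nat.not_lt_zero _)⟩

theorem placed_zero : placed 0 τ = ∅ := by
  ext y
  simp [placed]

theorem card_freshStarts_empty : (freshStarts P ∅).card = P.parts.card := by
  rw [← card_starts P]
  simp [freshStarts, IsStart]

theorem card_freshClosers_empty : (freshClosers P ∅).card = n - P.parts.card := by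
  have := card_closers_add_card_parts P
  simp only [freshClosers, IsStart, Finset.notMem_empty, not_false_eq_true, true_and,
    not_forall_not]
  omega

theorem card_parts_le (P : SetPartition n) : P.parts.card ≤ n := by
  have := card_closers_add_card_parts P
  omega

theorem card_compatible (t : Kind) (P : SetPartition n) :
    ((Finset.univ.filter fun σ => Compatible t σ P).card : ℚ) =
      n ! / (n - P.parts.card + 1)! := by
  have h := card_compatible_agree (t := t) (P := P) n 0 1 (zero_add n) compatibleUpTo_zero
  rw [placed_zero, card_freshStarts_empty, card_freshClosers_empty] at h
  simp only [extensions, AgreeUpTo, Nat.not_lt_zero, IsEmpty.forall_iff, implies_true, and_true] at h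
  have := card_parts_le P
  rw [h, completionCount, Nat.add_sub_cancel' this]
  simp [pending]

theorem card_compatible_uncovered (t : Kind) (P : SetPartition n) {d : ℕ} (hd : d ≤ P.parts.card) :
    ((Finset.univ.filter fun σ => Compatible t σ P ∧
      (Finset.univ.filter fun j => ¬ Covered t σ P j).card = d).card : ℚ) =
      ceilingDofCount n P.parts.card d := by
  have h := card_compatible_agree_uncovered (t := t) (P := P) n 0 d 1 (zero_add n)
    compatibleUpTo_zero
  rw [placed_zero, card_freshStarts_empty, card_freshClosers_empty] at h
  simp only [extensions, AgreeUpTo, Nat.not_lt_zero, IsEmpty.forall_iff, implies_true, true_and,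
    uncoveredFrom_zero] at h
  have hle := card_parts_le P
  have hp : (pending t P ∅).card = 0 := by simp [pending]
  rw [h, hp, completionCountBy, ceilingDofCount]
  rcases hle.eq_or_lt with hk | hk
  · rw [if_pos (by omega), if_pos hk, hk]
  · obtain ⟨m, hm⟩ : ∃ m, n = P.parts.card + m + 1 := ⟨n - P.parts.card - 1, by omega⟩
    rw [if_neg (by omega), if_neg hk.ne, if_pos hd,
      show n - P.parts.card - 1 = m by omega, show n - P.parts.card = m + 1 by omega,
      show m + 1 + (P.parts.card - d) - 1 = n - d - 1 by omega, Nat.factorial_succ m]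
    have := Nat.factorial_ne_zero m
    have := Nat.factorial_ne_zero (P.parts.card - d)
    push_cast
    field_simp
    ring

end Counting

/-! ### Counting regions -/

section RegionCounts

open scoped Classical

variable {n : ℕ} {t : Kind} {G : SimpleGraph (Fin n)} {P : SetPartition n}

theorem exists_compatible_of_isCeilingPartition {R : Set (Fin n → ℝ)}
    (hR : R ∈ regions (arrangement t G)) (hP : IsCeilingPartition t G R P) :
    ∃ σ, Compatible t σ P ∧ R = regionOf t G σ P := by
  obtain ⟨σ, Q, hc, hG, rfl⟩ := exists_eq_regionOf hR
  obtain rfl := (isCeilingPartition_regionOf hc hG).unique hP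
  exact ⟨σ, hc, rfl⟩

theorem ncard_regions (hG : IsGPartition G P) (D : Set (Fin n → ℝ) → Prop) :
    {R ∈ regions (arrangement t G) | IsCeilingPartition t G R P ∧ D R}.ncard =
      (Finset.univ.filter fun σ => Compatible t σ P ∧ D (regionOf t G σ P)).card := by
  have h : {R ∈ regions (arrangement t G) | IsCeilingPartition t G R P ∧ D R} =
      (fun σ => regionOf t G σ P) ''
        (Finset.univ.filter fun σ => Compatible t σ P ∧ D (regionOf t G σ P) :
          Finset (Equiv.Perm (Fin n))) := by
    ext R
    simp only [Set.mem_ofPred_eq, Finset.coe_filter, Finset.mem_univ, true_and, Set.mem_image]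
    constructor
    · rintro ⟨h1, h2, h3⟩
      obtain ⟨σ, hσ, rfl⟩ := exists_compatible_of_isCeilingPartition h1 h2
      exact ⟨σ, ⟨hσ, h3⟩, rfl⟩
    · rintro ⟨σ, ⟨hσ, h3⟩, rfl⟩
      exact ⟨regionOf_mem_regions, isCeilingPartition_regionOf hσ hG, h3⟩
  rw [h, Set.ncard_image_of_injective _ fun σ τ he => perm_eq_of_regionOf_eq he,
    Set.ncard_coe_finset]

theorem ncard_regions_isCeilingPartition (hG : IsGPartition G P) :
    ({R ∈ regions (arrangement t G) | IsCeilingPartition t G R P}.ncard : ℚ) =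
      (n ! : ℚ) / ((n - P.parts.card + 1)! : ℚ) := by
  have h := ncard_regions (t := t) hG fun _ => True
  simp only [and_true] at h
  rw [h, card_compatible]

theorem ncard_regions_degreesOfFreedom (hG : IsGPartition G P) {d : ℕ} (hd : d ≤ P.parts.card) :
    ({R ∈ regions (arrangement t G) |
      IsCeilingPartition t G R P ∧ degreesOfFreedom R = d}.ncard : ℚ) =
      ceilingDofCount n P.parts.card d := by
  rw [ncard_regions hG fun R => degreesOfFreedom R = d, ← card_compatible_uncovered t P hd]
  congr 2
  ext σ
  simp only [Finset.mem_filter, Finset.mem_univ, true_and]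
  refine and_congr_right fun hσ => ?_
  rw [degreesOfFreedom_regionOf hσ hG]

theorem exists_region_iff :
    (∃ R ∈ regions (arrangement t G), IsCeilingPartition t G R P) ↔ IsGPartition G P := by
  refine ⟨fun ⟨R, _, hR⟩ => hR.isGPartition, fun hG => ?_⟩
  -- Existence comes from the count being positive.
  have hne : (Finset.univ.filter fun σ => Compatible t σ P).Nonempty := by
    rw [← Finset.card_pos, ← Nat.cast_pos (α := ℚ), card_compatible]
    exact div_pos (by exact_mod_cast Nat.factorial_pos _) (by exact_mod_cast Nat.factorial_pos _)
  obtain ⟨σ, hσ⟩ := hne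
  exact ⟨_, regionOf_mem_regions, isCeilingPartition_regionOf (Finset.mem_filter.1 hσ).2 hG⟩

theorem existsUnique_isCeilingPartition {R : Set (Fin n → ℝ)}
    (hR : R ∈ regions (arrangement t G)) : ∃! P : SetPartition n, IsCeilingPartition t G R P := by
  obtain ⟨σ, P, hc, hG, rfl⟩ := exists_eq_regionOf hR
  exact ⟨P, isCeilingPartition_regionOf hc hG, fun Q hQ =>
    hQ.unique (isCeilingPartition_regionOf hc hG)⟩

theorem ncard_regions_numCeilings (t : Kind) (G : SimpleGraph (Fin n)) {c d : ℕ} (hd : 1 ≤ d)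
    (hdc : d ≤ n - c) :
    ({R ∈ regions (arrangement t G) |
        numCeilings (arrangement t G) R = c ∧ degreesOfFreedom R = d}.ncard : ℚ) =
      ∑ P : SetPartition n with IsGPartition G P ∧ P.parts.card = n - c,
        ceilingDofCount n (n - c) d := by
  let F : SetPartition n → Finset (Set (Fin n → ℝ)) := fun P =>
    (regions_finite (t := t) (G := G)).toFinset.filter fun R =>
      IsCeilingPartition t G R P ∧ degreesOfFreedom R = d
  have hF : ∀ P, (F P : Set (Set (Fin n → ℝ))) =
      {R ∈ regions (arrangement t G) | IsCeilingPartition t G R P ∧ degreesOfFreedom R = d} := by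
    intro P
    ext R
    simp [F]
  have hU : {R ∈ regions (arrangement t G) |
      numCeilings (arrangement t G) R = c ∧ degreesOfFreedom R = d} =
      (((Finset.univ.filter fun P : SetPartition n => IsGPartition G P ∧ P.parts.card = n - c).biUnion
        F : Finset (Set (Fin n → ℝ))) : Set (Set (Fin n → ℝ))) := by
    ext R
    simp only [Finset.coe_biUnion, Set.mem_iUnion, hF, Set.mem_ofPred_eq, Finset.coe_filter,
      Finset.mem_univ, true_and, exists_prop]
    constructor
    · rintro ⟨h1, h2, h3⟩
      obtain ⟨P, hP, -⟩ := existsUnique_isCeilingPartition h1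
      have := numCeilings_add_card_parts hP
      exact ⟨P, ⟨hP.isGPartition, by omega⟩, h1, hP, h3⟩
    · rintro ⟨P, ⟨-, hc⟩, h1, hP, h3⟩
      have := numCeilings_add_card_parts hP
      exact ⟨h1, by omega, h3⟩
  rw [hU, Set.ncard_coe_finset, Finset.card_biUnion, Nat.cast_sum]
  · refine Finset.sum_congr rfl fun P hP => ?_
    obtain ⟨-, hG, hc⟩ := Finset.mem_filter.1 hP
    rw [← Set.ncard_coe_finset, hF, ncard_regions_degreesOfFreedom hG (hc ▸ hdc), hc]
  · intro P _ Q _ hne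
    rw [Function.onFun, Finset.disjoint_left]
    intro R hR hR'
    exact hne ((Finset.mem_filter.1 hR).2.1.unique (Finset.mem_filter.1 hR').2.1)

theorem degreesOfFreedom_bounds (hn : 0 < n) {R : Set (Fin n → ℝ)}
    (hR : R ∈ regions (arrangement t G)) :
    1 ≤ degreesOfFreedom R ∧ degreesOfFreedom R ≤ n - numCeilings (arrangement t G) R := by
  obtain ⟨σ, P, hc, hG, rfl⟩ := exists_eq_regionOf hR
  have h1 := numCeilings_add_card_parts (isCeilingPartition_regionOf hc hG)
  have h2 := card_uncovered_le hc
  have h3 := card_uncovered_pos (t := t) (σ := σ) (P := P) hn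
  rw [degreesOfFreedom_regionOf hc hG]
  omega

theorem ncard_regions_shi_eq_ish (G : SimpleGraph (Fin n)) (c d : ℕ) :
    {R ∈ regions (arrangement Kind.shi G) |
      numCeilings (arrangement Kind.shi G) R = c ∧ degreesOfFreedom R = d}.ncard =
    {R ∈ regions (arrangement Kind.ish G) |
      numCeilings (arrangement Kind.ish G) R = c ∧ degreesOfFreedom R = d}.ncard := by
  by_cases hd : 1 ≤ d ∧ d ≤ n - c
  · rw [← Nat.cast_inj (R := ℚ), ncard_regions_numCeilings Kind.shi G hd.1 hd.2,
      ncard_regions_numCeilings Kind.ish G hd.1 hd.2]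
  -- Outside the range both sets are empty by `degreesOfFreedom_bounds`, which needs `n > 0`; for `n
  -- = 0` both arrangements are empty.
  · rcases n.eq_zero_or_pos with rfl | hn
    · have h : arrangement Kind.shi G = arrangement Kind.ish G := by
        ext H
        simp [arrangement]
      rw [h]
    · have he : ∀ t, {R ∈ regions (arrangement t G) |
          numCeilings (arrangement t G) R = c ∧ degreesOfFreedom R = d} = ∅ := by
        intro t
        rw [Set.eq_empty_iff_forall_notMem]
        rintro R ⟨hR, rfl, rfl⟩
        exact hd (degreesOfFreedom_bounds hn hR)
      rw [he, he]

end RegionCounts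

end ShiIsh
open ShiIsh in
open scoped Classical in
theorem mainTheorem1 (n : ℕ) (G : SimpleGraph (Fin n)) :
    (∀ t : Kind,
      (regions (arrangement t G)).Finite ∧
      (∀ R ∈ regions (arrangement t G), ∃! P : SetPartition n, IsCeilingPartition t G R P) ∧
      (∀ (P : SetPartition n) (k : ℕ), P.parts.card = k →
        ((∃ R ∈ regions (arrangement t G), IsCeilingPartition t G R P) ↔ IsGPartition G P) ∧
        (IsGPartition G P →
          (({R ∈ regions (arrangement t G) | IsCeilingPartition t G R P}.ncard : ℚ) =
            (n ! : ℚ) / ((n - k + 1)! : ℚ)) ∧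
          (∀ d : ℕ, 1 ≤ d → d ≤ k →
            ({R ∈ regions (arrangement t G) |
                IsCeilingPartition t G R P ∧ degreesOfFreedom R = d}.ncard : ℚ) =
              ceilingDofCount n k d))) ∧
      (∀ c d : ℕ, 1 ≤ d → d ≤ n - c →
        ({R ∈ regions (arrangement t G) |
            numCeilings (arrangement t G) R = c ∧ degreesOfFreedom R = d}.ncard : ℚ) =
          ∑ P : SetPartition n with IsGPartition G P ∧ P.parts.card = n - c,
            ceilingDofCount n (n - c) d)) ∧
    (∀ c d : ℕ,
      {R ∈ regions (arrangement Kind.shi G) |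
          numCeilings (arrangement Kind.shi G) R = c ∧ degreesOfFreedom R = d}.ncard =
        {R ∈ regions (arrangement Kind.ish G) |
          numCeilings (arrangement Kind.ish G) R = c ∧ degreesOfFreedom R = d}.ncard) := by
  refine ⟨fun t => ⟨regions_finite, fun R hR => existsUnique_isCeilingPartition hR, ?_,
    fun c d hd hdc => ncard_regions_numCeilings t G hd hdc⟩, ncard_regions_shi_eq_ish G⟩
  rintro P k rfl
  exact ⟨exists_region_iff, fun hG => ⟨ncard_regions_isCeilingPartition hG,
    fun d _ hd => ncard_regions_degreesOfFreedom hG hd⟩⟩
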